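/- Theorem 4.1. Let $N\ge 1$ and $M\ge 0$ be integers, let $\max(N-1,\tfrac12)<c<N$, and fix one of the signs $\pm$. Let $z=re^{i\theta}\neq 0$ be a point of the Riemann surface of the logarithm, with $r=|z|>0$, with $\theta=\arg z\in\mathbb R$ (not reduced modulo $2\pi$), and with $\ln z=\ln r+i\theta$. Put $$F(z)=\left(z-\tfrac12\right)\ln z-z+\tfrac12\ln(2\pi),\qquad TS_N(z)=z\sum_{k=1}^{N-1}\frac{(-1)^k}{(2z)^{2k}}\,\Gamma(2k-1)\,c_k(1),$$ where $c_k(x)=\sum_{j=0}^{k}\frac{(-1)^j}{(2j)!}\,c_{k-j}\,x^j$ are the cosecant polynomials, with the cosecant numbers $c_k=2(1-2^{1-2k})\zeta(2k)/\pi^{2k}$. Put also $$I_M(z)=\int_{c-i\infty}^{c+i\infty}\left(\frac1{2\pi z}\right)^{2s}\frac{e^{\pm 2Mi\pi s}}{e^{-i\pi s}-e^{i\pi s}}\,\zeta(2s)\,\Gamma(2s-1)\,ds,\qquad \left(\frac1{2\pi z}\right)^{2s}=e^{-2s(\ln(2\pi)+\ln z)},$$ $$S_{MB}(M,z)=\pm\lfloor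 M/2\rfloor\ln\left(-e^{-2i\pi z}\right)-\frac{1-(-1)^M}{2}\ln\left(1-e^{\pm2i\pi z}\right),$$ with principal logarithms in $S_{MB}$. Suppose that $(\pm M-1)\pi<\theta<(\pm M+1)\pi$. Then the integral $I_M(z)$ converges absolutely, and the following hold. (a) If $\theta$ is not a half-integer multiple of $\pi$ and $z$ is not a pole of $\Gamma$, then $$\ln\Gamma(z)=F(z)+TS_N(z)-2z\,I_M(z)+S_{MB}(M,z).$$ Here $\ln\Gamma$ is the multivalued logarithm of $\Gamma$, so that the right-hand side is a logarithm of $\Gamma(z)$; if $|\theta|<\pi$, it is the value of the principal branch, the one analytic on $\mathbb C\setminus(-\infty,0]$ and zero at $z=1$. (b) If $\theta=\pm(M-\tfrac12)\pi$, then the formula in (a) holds with $S_{MB}(M,z)$ replaced by the real number $$\frac{(-1)^M-1}{2}\ln\left(1-e^{-2\pi|z|}\right)+2(-1)^{M+1}\lfloor M/2\rfloor\,\pi|z|.$$ (c) If $\theta=\pm(M+\tfrac12)\pi$, then the formula in (a) holds with $S_{MB}(M,z)$ replaced by the real number $$\frac{(-1)^M-1}{2}\ln\left(1-e^{-2\pi|z|}\right)+2\pi|z|\left((-1)^M\lfloor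 M/2\rfloor+\frac{(-1)^M-1}{2}\right).$$ In (b) and (c), where the right-hand side of (a) may jump, the left-hand side $\ln\Gamma(z)$ means the mid-point $\tfrac12(a+b)$ of the one-sided limits $a$ and $b$, as $\arg z$ tends to $\theta$ from below and from above with $|z|$ fixed, of the values of $\ln\Gamma$ given by the right-hand side of (a). These limits exist, and each of them is a value of $\ln\Gamma(z)$ in the sense of (a), hence the principal value if $|\theta|<\pi$. -/

import Mathlib

open Filter Topology

noncomputable section

namespace Stirling

/-- A point of the Riemann surface of the logarithm is given by its modulus `r > 0` and its
argument `θ`, an arbitrary real number. This is the underlying complex number `z = r e^{iθ}`. -/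
def point (r θ : ℝ) : ℂ := (r : ℂ) * Complex.exp ((θ : ℂ) * Complex.I)

/-- `ln z = ln r + iθ` on the Riemann surface of the logarithm. -/
def surfaceLog (r θ : ℝ) : ℂ := (Real.log r : ℂ) + (θ : ℂ) * Complex.I

/-- The Stirling approximation `F(z) = (z - 1/2) ln z - z + (1/2) ln (2π)`. -/
def leadingTerms (r θ : ℝ) : ℂ :=
  (point r θ - 1 / 2) * surfaceLog r θ - point r θ + (1 / 2) * (Real.log (2 * Real.pi) : ℂ)

/-- The cosecant numbers `c_k = 2 (1 - 2^{1-2k}) ζ(2k) / π^{2k}`, so `c_0 = 1`, `c_1 = 1/6`. -/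
def cosecantNumber (k : ℕ) : ℂ :=
  2 * (1 - (2 : ℂ) ^ (1 - 2 * (k : ℤ))) * riemannZeta (2 * (k : ℂ)) / (Real.pi : ℂ) ^ (2 * k)

/-- The cosecant polynomials `c_k(x) = ∑_{j=0}^{k} (-1)^j / (2j)! c_{k-j} x^j`. -/
def cosecantPoly (k : ℕ) (x : ℂ) : ℂ :=
  ∑ j ∈ Finset.range (k + 1),
    (-1 : ℂ) ^ j / (Nat.factorial (2 * j) : ℂ) * cosecantNumber (k - j) * x ^ j

/-- The Stirling series truncated at `N`:
`z ∑_{k=1}^{N-1} (-1)^k / (2z)^{2k} Γ(2k-1) c_k(1)`. -/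
def truncatedSeries (N : ℕ) (z : ℂ) : ℂ :=
  z * ∑ k ∈ Finset.Ico 1 N,
    (-1 : ℂ) ^ k / (2 * z) ^ (2 * k) * Complex.Gamma (2 * (k : ℂ) - 1) * cosecantPoly k 1

/-- The integrand
`(1/(2πz))^{2s} e^{±2Miπs} / (e^{-iπs} - e^{iπs}) ζ(2s) Γ(2s-1)` of the Mellin-Barnes integral.
The sign is `ε = ±1`, and the power of `2πz` is taken on the Riemann surface of the logarithm. -/
def mbIntegrand (ε : ℝ) (M : ℕ) (r θ : ℝ) (s : ℂ) : ℂ :=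
  Complex.exp (-2 * s * ((Real.log (2 * Real.pi) : ℂ) + surfaceLog r θ)) *
    (Complex.exp ((ε : ℂ) * 2 * (M : ℂ) * Complex.I * (Real.pi : ℂ) * s) /
      (Complex.exp (-Complex.I * (Real.pi : ℂ) * s) - Complex.exp (Complex.I * (Real.pi : ℂ) * s))) *
    riemannZeta (2 * s) * Complex.Gamma (2 * s - 1)

/-- The integral of `mbIntegrand` upwards along the vertical line `Re s = c`
(here `s = c + it` and `ds = i dt`). -/
def mbIntegral (ε : ℝ) (M : ℕ) (c r θ : ℝ) : ℂ :=
  Complex.I * ∫ t : ℝ, mbIntegrand ε M r θ ((c : ℂ) + (t : ℂ) * Complex.I)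

/-- `S_MB(M, z)` off the half-integer rays, with principal logarithms. -/
def sMB (ε : ℝ) (M : ℕ) (z : ℂ) : ℂ :=
  (ε : ℂ) * ((M / 2 : ℕ) : ℂ) * Complex.log (-Complex.exp (-2 * Complex.I * (Real.pi : ℂ) * z)) -
    ((1 - (-1 : ℂ) ^ M) / 2) *
      Complex.log (1 - Complex.exp ((ε : ℂ) * 2 * Complex.I * (Real.pi : ℂ) * z))

/-- `S_MB(M, z)` for `arg z = ±(M - 1/2)π`, `|z| = r`. -/
def sMBInner (M : ℕ) (r : ℝ) : ℝ :=
  (((-1 : ℝ) ^ M - 1) / 2) * Real.log (1 - Real.exp (-2 * Real.pi * r)) +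
    2 * (-1 : ℝ) ^ (M + 1) * ((M / 2 : ℕ) : ℝ) * Real.pi * r

/-- `S_MB(M, z)` for `arg z = ±(M + 1/2)π`, `|z| = r`. -/
def sMBOuter (M : ℕ) (r : ℝ) : ℝ :=
  (((-1 : ℝ) ^ M - 1) / 2) * Real.log (1 - Real.exp (-2 * Real.pi * r)) +
    2 * Real.pi * r * ((-1 : ℝ) ^ M * ((M / 2 : ℕ) : ℝ) + ((-1 : ℝ) ^ M - 1) / 2)

/-- The right-hand side of the formula for `ln Γ(z)`, with `S` in the place of `S_MB(M, z)`. -/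
def mbFormula (N : ℕ) (ε : ℝ) (M : ℕ) (c r θ : ℝ) (S : ℂ) : ℂ :=
  leadingTerms r θ + truncatedSeries N (point r θ) - 2 * point r θ * mbIntegral ε M c r θ + S

/-- The principal branch of `ln Γ` on `ℂ ∖ (-∞, 0]`: the primitive of the digamma function
`Γ'/Γ` that vanishes at `1`, as an integral over the segment from `1` to `z`. -/
def logGamma (z : ℂ) : ℂ :=
  ∫ t in (0 : ℝ)..1, (z - 1) * Complex.digamma (1 + (t : ℂ) * (z - 1))

/-- `w` is a value of the multivalued function `ln Γ` at the point with modulus `r` and argument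
`θ`; for `|θ| < π` it has to be the value of the principal branch. -/
def IsLnGamma (r θ : ℝ) (w : ℂ) : Prop :=
  Complex.exp w = Complex.Gamma (point r θ) ∧ (|θ| < Real.pi → w = logGamma (point r θ))

/-- `w` is the mid-point of the two one-sided limits, as the argument tends to `θ` from the left
and from the right, of the determination `L` of `ln Γ` along the circle of radius `r`; both limits
are values of `ln Γ` at the point with argument `θ`. -/
def IsMidpointLnGamma (L : ℝ → ℂ) (r θ : ℝ) (w : ℂ) : Prop :=
  ∃ a b : ℂ, Tendsto L (𝓝[<] θ) (𝓝 a) ∧ Tendsto L (𝓝[>] θ) (𝓝 b) ∧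
    IsLnGamma r θ a ∧ IsLnGamma r θ b ∧ w = (a + b) / 2

end Stirling

end

/-! On the positive axis the theorem is Binet's formula, ln Γ(x) = F(x) + ∫₀^∞ e^{-xt} k(t) dt with
k(t) = ∑ 2/(t² + (2πn)²). It follows from Bohr–Mollerup uniqueness: the right side is convex,
satisfies f(x+1) = f(x) + ln x, and is normalised by Stirling's formula for n!
(`log_Gamma_eq_add_binetIntegral`).

Expand each 2/(t² + a²), a = 2πn, geometrically to N-1 terms. The terms, summed over n, give TS_N
because c_k(1) = -2ζ(2k)/π^{2k} (`cosecantPoly_one`). The remainder is an inverse Mellin integral of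
1/sin(πs) over Re s = c. Its Laplace transform contributes Γ(2s-1) and the sum over n contributes
ζ(2s) (`binetIntegral_eq_add_mbLine`). On the line the integrand decays at every exponential rate
below 2π, so the integral is holomorphic in ln(2πz) for |arg z| < π. The identity theorem then gives
the case M = 0 for the principal branch (`logGamma_eq_stirlingLog`).

For general M the factor e^{±2Miπs} merely turns arg z by ∓Mπ, so I_M(z) is the remainder for M = 0
at (-1)^M z (`mbIntegrand_eq`, `mbFormula_eq`). For even M only the branch of ln z in F changes; for
odd M the reflection formula returns from -z to z. Exponentiating shows that S_MB corrects exactly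
this (`exp_mbCore_add_sMB`). When |θ| < π only M = 0, 1 occur, and the multiple of 2πi is fixed by
continuity and a reality argument on the imaginary axis (`mbCore_one_add_sMB_principal`).

Everything except S_MB is continuous in θ. On the rays of (b) and (c) its logarithms meet their cuts
from opposite sides, so the one-sided limits are S ± K and S is their mid-point
(`isMidpointLnGamma_of_sMB`). -/

noncomputable section

namespace Stirling

/-! ### Bernoulli numbers and the values of the cosecant polynomials at 1. -/

open PowerSeries in
/-- The Bernoulli numbers satisfy `∑ C(n,m) (2^m - 2) B_m = -2^n B_n` for `n ≥ 2`, here as an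
identity of exponential generating functions. -/
lemma rescale_bernoulliPowerSeries_identity :
    (rescale (2 : ℚ) (bernoulliPowerSeries ℚ) - 2 * bernoulliPowerSeries ℚ) * exp ℚ =
      -(rescale (2 : ℚ) (bernoulliPowerSeries ℚ) + 2 * X) := by
  have h1 := bernoulliPowerSeries_mul_exp_sub_one ℚ
  have h2 : rescale (2 : ℚ) (bernoulliPowerSeries ℚ) * (exp ℚ ^ 2 - 1) = 2 * X := by
    have := congrArg (rescale (2 : ℚ)) h1
    rw [map_mul, map_sub, map_one, rescale_X] at this
    rw [exp_pow_eq_rescale_exp]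
    rw [← map_ofNat (C (R := ℚ)) 2]
    simpa using this
  have hne : exp ℚ ^ 2 - 1 ≠ 0 := by
    intro h
    rw [h, mul_zero] at h2
    have := congrArg (coeff 1) h2
    rw [← map_ofNat (C (R := ℚ)) 2, coeff_C_mul] at this
    simp at this
  apply mul_right_cancel₀ hne
  -- After multiplication by e^{2X} - 1 both sides equal -2X e^{2X}.
  linear_combination (exp ℚ + 1) * h2 - 2 * exp ℚ * (exp ℚ + 1) * h1

lemma sum_choose_mul_two_pow_sub_two_mul_bernoulli {n : ℕ} (hn : 2 ≤ n) :
    ∑ m ∈ Finset.range (n + 1),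
      ((2 : ℚ) ^ m - 2) * bernoulli m / (m.factorial : ℚ) * (1 / ((n - m).factorial : ℚ)) =
      -(2 ^ n * bernoulli n / (n.factorial : ℚ)) := by
  have h := congrArg (PowerSeries.coeff n) rescale_bernoulliPowerSeries_identity
  rw [PowerSeries.coeff_mul, Finset.Nat.sum_antidiagonal_eq_sum_range_succ_mk] at h
  have h2 : (2 : PowerSeries ℚ) = PowerSeries.C (2 : ℚ) := (map_ofNat (PowerSeries.C (R := ℚ)) 2).symm
  rw [h2] at h
  simp only [map_sub, map_neg, map_add, PowerSeries.coeff_C_mul, PowerSeries.coeff_rescale,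
    bernoulliPowerSeries, PowerSeries.coeff_mk, PowerSeries.coeff_exp, PowerSeries.coeff_X] at h
  -- The summand 2X is seen only by the coefficient n = 1.
  rw [if_neg (by omega)] at h
  simp only [eq_ratCast, Rat.cast_id] at h
  convert h using 1
  · exact Finset.sum_congr rfl fun m _ => by ring
  · ring

lemma cosecantNumber_eq_bernoulli (k : ℕ) :
    cosecantNumber k =
      (-1) ^ (k + 1) * (2 ^ (2 * k) - 2) * (bernoulli (2 * k) : ℂ) / ((2 * k).factorial : ℂ) := by
  unfold cosecantNumber
  rcases eq_or_ne k 0 with rfl | hk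
  -- Euler's formula for ζ(2k) needs k ≠ 0; here ζ(0) = -1/2 gives c_0 = 1.
  · simp [riemannZeta_zero]; norm_num
  · rw [riemannZeta_two_mul_nat hk]
    have hπ : (Real.pi : ℂ) ≠ 0 := by exact_mod_cast Real.pi_ne_zero
    have h1 : (2 : ℂ) ^ (1 - 2 * (k : ℤ)) = 2 / 2 ^ (2 * k) := by
      rw [zpow_sub₀ two_ne_zero]; norm_cast
    have h2 : (2 : ℂ) ^ (2 * k) = 2 * 2 ^ (2 * k - 1) := by
      rw [← pow_succ']; congr 1; omega
    rw [h1, h2]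
    field_simp

/-- The values at `1` of the cosecant polynomials are the coefficients of `x cot x`. -/
lemma cosecantPoly_one {k : ℕ} (hk : 1 ≤ k) :
    cosecantPoly k 1 = -2 * riemannZeta (2 * (k : ℂ)) / (Real.pi : ℂ) ^ (2 * k) := by
  have hπ : (Real.pi : ℂ) ≠ 0 := by exact_mod_cast Real.pi_ne_zero
  have key := congrArg (fun q : ℚ => (q : ℂ))
    (sum_choose_mul_two_pow_sub_two_mul_bernoulli (n := 2 * k) (by omega))
  -- Odd indices drop out: `bernoulli m` vanishes for odd m > 1, and at m = 1 the factor 2^m - 2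
  -- does.
  have hodd : ∑ m ∈ Finset.range (2 * k + 1),
      ((2 : ℚ) ^ m - 2) * bernoulli m / (m.factorial : ℚ) * (1 / ((2 * k - m).factorial : ℚ)) =
      ∑ i ∈ Finset.range (k + 1), ((2 : ℚ) ^ (2 * i) - 2) * bernoulli (2 * i) /
        ((2 * i).factorial : ℚ) * (1 / ((2 * k - 2 * i).factorial : ℚ)) := by
    rw [← Finset.sum_image (s := Finset.range (k + 1)) (g := fun i => 2 * i)
      (f := fun m => ((2 : ℚ) ^ m - 2) * bernoulli m / (m.factorial : ℚ) *
        (1 / ((2 * k - m).factorial : ℚ))) (by intro a _ b _ h; simpa using h)]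
    symm
    apply Finset.sum_subset
    · intro m hm
      simp only [Finset.mem_image, Finset.mem_range] at hm ⊢
      omega
    · intro m hm hm'
      have hmo : Odd m := by
        rw [← Nat.not_even_iff_odd]
        rintro ⟨i, rfl⟩
        apply hm'
        simp only [Finset.mem_image, Finset.mem_range] at hm ⊢
        exact ⟨i, by omega, by omega⟩
      rcases eq_or_ne m 1 with rfl | h1
      · norm_num
      · rw [bernoulli_eq_zero_of_odd hmo (by have := hmo.pos; omega)]; simp
  rw [hodd] at key
  push_cast at key
  unfold cosecantPoly
  rw [← Finset.sum_range_reflect, riemannZeta_two_mul_nat (by omega)]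
  have h2 : (2 : ℂ) ^ (2 * k) = 2 * 2 ^ (2 * k - 1) := by
    rw [← pow_succ']; congr 1; omega
  have : ∀ j ∈ Finset.range (k + 1),
      (-1 : ℂ) ^ (k + 1 - 1 - j) / (Nat.factorial (2 * (k + 1 - 1 - j)) : ℂ) *
        cosecantNumber (k - (k + 1 - 1 - j)) * 1 ^ (k + 1 - 1 - j) =
      (-1) ^ (k + 1) * (((2 : ℂ) ^ (2 * j) - 2) * bernoulli (2 * j) /
        ((2 * j).factorial : ℂ) * (1 / ((2 * k - 2 * j).factorial : ℂ))) := by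
    intro j hj
    have hj' : j ≤ k := by simp at hj; omega
    obtain ⟨i, rfl⟩ := Nat.exists_eq_add_of_le hj'
    have e1 : j + i + 1 - 1 - j = i := by omega
    have e2 : j + i - i = j := by omega
    have e3 : 2 * (j + i) - 2 * j = 2 * i := by omega
    rw [e1, e2, e3, cosecantNumber_eq_bernoulli]
    ring
  rw [Finset.sum_congr rfl this, ← Finset.mul_sum, key, h2]
  field_simp

/-! ### Binet's formula on the positive real axis. -/

open MeasureTheory Set

/-- The kernel `k(t) = ∑_{n ≥ 1} 2 / (t² + 4π²n²)` of Binet's integral. -/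
def binetKernel (t : ℝ) : ℝ := ∑' n : ℕ, 2 / (t ^ 2 + (2 * Real.pi * (n + 1)) ^ 2)

lemma summable_binetBound : Summable fun n : ℕ => 2 / (2 * Real.pi * ((n : ℝ) + 1)) ^ 2 := by
  have h := (summable_nat_add_iff 1).mpr (Real.summable_one_div_nat_pow.mpr one_lt_two)
  refine (h.mul_left (2 / (2 * Real.pi) ^ 2)).congr fun n => ?_
  have := Real.pi_pos
  push_cast
  field_simp

lemma binetTerm_nonneg (t : ℝ) (n : ℕ) : 0 ≤ 2 / (t ^ 2 + (2 * Real.pi * ((n : ℝ) + 1)) ^ 2) := by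
  positivity

lemma binetTerm_le (t : ℝ) (n : ℕ) :
    2 / (t ^ 2 + (2 * Real.pi * ((n : ℝ) + 1)) ^ 2) ≤ 2 / (2 * Real.pi * ((n : ℝ) + 1)) ^ 2 := by
  have := Real.pi_pos
  gcongr
  nlinarith [sq_nonneg t]

lemma summable_binetTerm (t : ℝ) :
    Summable fun n : ℕ => 2 / (t ^ 2 + (2 * Real.pi * ((n : ℝ) + 1)) ^ 2) :=
  summable_binetBound.of_nonneg_of_le (binetTerm_nonneg t) (binetTerm_le t)

lemma binetKernel_nonneg (t : ℝ) : 0 ≤ binetKernel t := tsum_nonneg (binetTerm_nonneg t)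

lemma binetKernel_le (t : ℝ) : binetKernel t ≤ ∑' n : ℕ, 2 / (2 * Real.pi * ((n : ℝ) + 1)) ^ 2 :=
  (summable_binetTerm t).tsum_le_tsum (binetTerm_le t) summable_binetBound

lemma continuous_binetKernel : Continuous binetKernel := by
  have hpi := Real.pi_pos
  refine continuous_tsum (fun n => ?_) summable_binetBound fun n t => ?_
  · exact continuous_const.div (by fun_prop) fun t => by positivity
  · rw [Real.norm_of_nonneg (binetTerm_nonneg t n)]; exact binetTerm_le t n

/-- The Mittag-Leffler expansion of the hyperbolic cotangent. -/
lemma mul_binetKernel {t : ℝ} (ht : 0 < t) :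
    t * binetKernel t = 1 / (Real.exp t - 1) - 1 / t + 1 / 2 := by
  have hpi := Real.pi_pos
  have hpi' : (Real.pi : ℂ) ≠ 0 := by exact_mod_cast hpi.ne'
  have ht' : (t : ℂ) ≠ 0 := by exact_mod_cast ht.ne'
  -- At this point the expansion of π cot(πz) becomes that of coth(t/2).
  set z : ℂ := Complex.I * t / (2 * Real.pi) with hz
  have hzim : z.im = t / (2 * Real.pi) := by
    have : z = ((t / (2 * Real.pi) : ℝ) : ℂ) * Complex.I := by rw [hz]; push_cast; ring
    rw [this, Complex.im_ofReal_mul, Complex.I_im, mul_one]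
  have hzi : z ∈ Complex.integerComplement := by
    rintro ⟨n, hn⟩
    have : z.im = 0 := by rw [← hn]; simp
    rw [hzim] at this
    have : 0 < t / (2 * Real.pi) := by positivity
    linarith
  have h := cot_series_rep' hzi
  have hexp : Complex.exp t ≠ 1 := by
    intro h1
    have : Real.exp t = 1 := by exact_mod_cast h1
    have := Real.one_lt_exp_iff.mpr ht
    linarith
  have hcot : Complex.cot (Real.pi * z) =
      -Complex.I * ((Complex.exp t + 1) / (Complex.exp t - 1)) := by
    rw [Complex.cot_eq_exp_ratio]
    have : 2 * Complex.I * (Real.pi * z) = -(t : ℂ) := by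
      rw [hz]; field_simp; rw [Complex.I_sq]
    rw [this, Complex.exp_neg]
    have h1 : Complex.exp t - 1 ≠ 0 := sub_ne_zero.mpr hexp
    have h2 : 1 - (Complex.exp t)⁻¹ ≠ 0 := by
      intro h3
      apply h1
      have := Complex.exp_ne_zero t
      field_simp at h3
      simpa using h3
    have h3 := Complex.exp_ne_zero t
    have h4 := Complex.I_ne_zero
    rw [div_eq_iff (mul_ne_zero h4 h2)]
    field_simp
    rw [Complex.I_sq]; ring
  have hterm : ∀ n : ℕ, 1 / (z - (n + 1)) + 1 / (z + (n + 1)) =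
      (-2 * Real.pi * Complex.I * t) * ((2 / (t ^ 2 + (2 * Real.pi * ((n : ℝ) + 1)) ^ 2) : ℝ) : ℂ) := by
    intro n
    have hne : ∀ s : ℝ, z + s ≠ 0 := by
      intro s h0
      have := congrArg Complex.im h0
      simp [hzim] at this
      have : 0 < t / (2 * Real.pi) := by positivity
      simp_all
    have h1 := hne (n + 1)
    have h2 := hne (-(n + 1))
    have h3 : ((t ^ 2 + (2 * Real.pi * ((n : ℝ) + 1)) ^ 2 : ℝ) : ℂ) ≠ 0 := by
      norm_cast; positivity
    push_cast at h1 h2 h3 ⊢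
    have h2' : z - (n + 1) ≠ 0 := by rwa [sub_eq_add_neg]
    have h4 : (z - (n + 1)) * (z + (n + 1)) =
        -(t ^ 2 + (2 * Real.pi * ((n : ℂ) + 1)) ^ 2) / (2 * Real.pi) ^ 2 := by
      rw [hz]; field_simp; ring_nf; rw [Complex.I_sq]; ring
    rw [div_add_div _ _ h2' h1, h4, hz]
    field_simp
    ring
  rw [hcot] at h
  simp_rw [hterm] at h
  rw [tsum_mul_left, ← Complex.ofReal_tsum] at h
  change _ = _ * (binetKernel t : ℂ) at h
  have h1 : Complex.exp t - 1 ≠ 0 := sub_ne_zero.mpr hexp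
  have : ((t * binetKernel t : ℝ) : ℂ) = ((1 / (Real.exp t - 1) - 1 / t + 1 / 2 : ℝ) : ℂ) := by
    push_cast
    have h5 : (-2 * Real.pi * Complex.I) ≠ 0 := by simp [hpi.ne']
    apply mul_left_cancel₀ h5
    rw [← mul_assoc, ← h, hz]
    field_simp
    ring_nf
    simp only [Complex.I_sq]
    ring
  exact_mod_cast this

/-- Binet's integral `∫₀^∞ e^{-xt} k(t) dt`, the remainder of Stirling's formula. -/
def binetIntegral (x : ℝ) : ℝ := ∫ t in Ioi (0 : ℝ), Real.exp (-x * t) * binetKernel t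

lemma integrableOn_exp_neg_mul {x : ℝ} (hx : 0 < x) :
    IntegrableOn (fun t => Real.exp (-x * t)) (Ioi 0) := exp_neg_integrableOn_Ioi 0 hx

lemma integrableOn_binet {x : ℝ} (hx : 0 < x) :
    IntegrableOn (fun t => Real.exp (-x * t) * binetKernel t) (Ioi 0) := by
  refine (integrableOn_exp_neg_mul hx).mul_bdd
    (c := ∑' n : ℕ, 2 / (2 * Real.pi * ((n : ℝ) + 1)) ^ 2)
    continuous_binetKernel.aestronglyMeasurable ?_
  filter_upwards with t
  rw [Real.norm_of_nonneg (binetKernel_nonneg t)]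
  exact binetKernel_le t

lemma integral_exp_neg_mul {x : ℝ} (hx : 0 < x) :
    ∫ t in Ioi (0 : ℝ), Real.exp (-x * t) = 1 / x := by
  rw [integral_exp_mul_Ioi (by linarith) 0]
  simp [neg_div_neg_eq]

/-- The right side is (1 - e^{-t}) k(t), the kernel that appears in the difference of Binet
integrals at x and x + 1. -/
lemma integral_half_sub_mul_exp {t : ℝ} (ht : 0 < t) :
    ∫ u in (0 : ℝ)..1, (1 / 2 - u) * Real.exp (-u * t) =
      (1 + Real.exp (-t)) / (2 * t) - (1 - Real.exp (-t)) / t ^ 2 := by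
  rw [intervalIntegral.integral_eq_sub_of_hasDerivAt
    (f := fun u => Real.exp (-u * t) * ((u - 1 / 2) / t + 1 / t ^ 2))]
  · simp; field_simp; ring
  · intro u _
    have h1 : HasDerivAt (fun u : ℝ => Real.exp (-u * t)) (Real.exp (-u * t) * (-1 * t)) u :=
      (((hasDerivAt_id u).neg).mul_const t).exp
    have h2 : HasDerivAt (fun u : ℝ => (u - 1 / 2) / t + 1 / t ^ 2) (1 / t) u :=
      (((hasDerivAt_id u).sub_const _).div_const t).add_const _
    have ht0 : t ≠ 0 := ht.ne'
    refine (h1.mul h2).congr_deriv ?_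
    field_simp
    ring
  · exact (by fun_prop : Continuous _).intervalIntegrable _ _

lemma integral_half_sub_div {x : ℝ} (hx : 0 < x) :
    ∫ u in (0 : ℝ)..1, (1 / 2 - u) * (1 / (x + u)) =
      (x + 1 / 2) * (Real.log (x + 1) - Real.log x) - 1 := by
  have hpos : ∀ u ∈ uIcc (0 : ℝ) 1, x + u ≠ 0 := by
    intro u hu
    rw [uIcc_of_le zero_le_one] at hu
    linarith [hu.1]
  rw [intervalIntegral.integral_eq_sub_of_hasDerivAt
    (f := fun u => (x + 1 / 2) * Real.log (x + u) - u)]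
  · simp; ring
  · intro u hu
    have h0 := hpos u hu
    have h1 : HasDerivAt (fun u : ℝ => Real.log (x + u)) (1 / (x + u)) u :=
      ((hasDerivAt_id u).const_add x).log h0
    refine ((h1.const_mul (x + 1 / 2)).sub (hasDerivAt_id u)).congr_deriv ?_
    field_simp
    ring
  · apply ContinuousOn.intervalIntegrable
    exact (by fun_prop : Continuous fun u : ℝ => 1 / 2 - u).continuousOn.mul
      (continuousOn_const.div (by fun_prop) hpos)

/-- Writing (1 - e^{-t}) k(t) as ∫₀¹ (1/2 - u) e^{-ut} du and swapping the integrals leaves ∫₀¹ (1/2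
- u)/(x + u) du. This is the functional equation required by Bohr–Mollerup. -/
lemma binetIntegral_sub {x : ℝ} (hx : 0 < x) :
    binetIntegral x - binetIntegral (x + 1) =
      (x + 1 / 2) * (Real.log (x + 1) - Real.log x) - 1 := by
  rw [binetIntegral, binetIntegral,
    ← integral_sub (integrableOn_binet hx) (integrableOn_binet (by linarith)),
    ← integral_half_sub_div hx]
  have h1 : ∀ t ∈ Ioi (0 : ℝ), Real.exp (-x * t) * binetKernel t -
      Real.exp (-(x + 1) * t) * binetKernel t =
      ∫ u in Ioc (0 : ℝ) 1, (1 / 2 - u) * Real.exp (-(x + u) * t) := by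
    intro t ht
    have ht : 0 < t := ht
    rw [← intervalIntegral.integral_of_le zero_le_one]
    have : ∀ u : ℝ, (1 / 2 - u) * Real.exp (-(x + u) * t) =
        Real.exp (-x * t) * ((1 / 2 - u) * Real.exp (-u * t)) := by
      intro u
      rw [show -(x + u) * t = -x * t + -u * t by ring, Real.exp_add]; ring
    simp_rw [this]
    rw [intervalIntegral.integral_const_mul, integral_half_sub_mul_exp ht]
    have hk : binetKernel t = (1 / (Real.exp t - 1) - 1 / t + 1 / 2) / t := by
      rw [← mul_binetKernel ht]; field_simp
    rw [show -(x + 1) * t = -x * t + -t by ring, Real.exp_add, hk, Real.exp_neg]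
    have : Real.exp t - 1 ≠ 0 := by
      have := Real.one_lt_exp_iff.mpr ht
      linarith
    have := Real.exp_pos t
    field_simp
    ring
  rw [setIntegral_congr_fun measurableSet_Ioi h1, intervalIntegral.integral_of_le zero_le_one,
    integral_integral_swap]
  · refine setIntegral_congr_fun measurableSet_Ioc fun u hu => ?_
    rw [integral_const_mul, integral_exp_neg_mul (by linarith [hu.1])]
  · have hdom : Integrable (fun p : ℝ × ℝ => Real.exp (-x * p.1) * (1 : ℝ))
        ((volume.restrict (Ioi 0)).prod (volume.restrict (Ioc (0 : ℝ) 1))) :=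
      Integrable.mul_prod (f := fun t => Real.exp (-x * t)) (g := fun _ => (1 : ℝ))
        (integrableOn_exp_neg_mul hx) (integrable_const _)
    refine hdom.mono ((by fun_prop : Continuous _).aestronglyMeasurable) ?_
    rw [Measure.prod_restrict]
    refine (ae_restrict_mem (measurableSet_Ioi.prod measurableSet_Ioc)).mono ?_
    rintro ⟨t, u⟩ ⟨ht, hu⟩
    simp only [mem_Ioi, mem_Ioc] at ht hu
    simp only [Function.uncurry, norm_mul, Real.norm_eq_abs, Real.abs_exp, mul_one]
    calc |1 / 2 - u| * Real.exp (-(x + u) * t) ≤ 1 * Real.exp (-x * t) := by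
          gcongr
          · rw [abs_le]; constructor <;> linarith
          · nlinarith
      _ = _ := one_mul _

lemma binetIntegral_nonneg (x : ℝ) : 0 ≤ binetIntegral x :=
  integral_nonneg fun t => mul_nonneg (Real.exp_pos _).le (binetKernel_nonneg t)

lemma tendsto_binetIntegral : Tendsto binetIntegral atTop (𝓝 0) := by
  set K := ∑' n : ℕ, 2 / (2 * Real.pi * ((n : ℝ) + 1)) ^ 2
  have h0 : Tendsto (fun x : ℝ => K * (1 / x)) atTop (𝓝 0) := by
    simpa using (tendsto_inv_atTop_zero (𝕜 := ℝ)).const_mul K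
  refine tendsto_of_tendsto_of_tendsto_of_le_of_le' tendsto_const_nhds h0
    (Eventually.of_forall binetIntegral_nonneg) ?_
  filter_upwards [eventually_gt_atTop 0] with x hx
  rw [← integral_exp_neg_mul hx, ← integral_const_mul]
  refine setIntegral_mono (integrableOn_binet hx) ((integrableOn_exp_neg_mul hx).const_mul K) ?_
  intro t
  exact (mul_le_mul_of_nonneg_left (binetKernel_le t) (Real.exp_pos _).le).trans_eq (mul_comm _ _)

/-- Each x ↦ e^{-xt} is convex and the kernel is nonnegative. -/
lemma convexOn_binetIntegral : ConvexOn ℝ (Ioi 0) binetIntegral := by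
  refine ⟨convex_Ioi 0, fun x hx y hy a b ha hb hab => ?_⟩
  have hxy : 0 < a • x + b • y := (convex_Ioi (0 : ℝ)) hx hy ha hb hab
  simp only [smul_eq_mul] at hxy ⊢
  rw [binetIntegral, binetIntegral, binetIntegral, ← integral_const_mul, ← integral_const_mul,
    ← integral_add ((integrableOn_binet hx).const_mul a) ((integrableOn_binet hy).const_mul b)]
  refine setIntegral_mono (integrableOn_binet hxy)
    (((integrableOn_binet hx).const_mul a).add ((integrableOn_binet hy).const_mul b)) fun t => ?_
  have := convexOn_exp.2 (mem_univ (-x * t)) (mem_univ (-y * t)) ha hb hab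
  simp only [smul_eq_mul] at this
  rw [show a * (-x * t) + b * (-y * t) = -(a * x + b * y) * t by ring] at this
  calc _ ≤ (a * Real.exp (-x * t) + b * Real.exp (-y * t)) * binetKernel t :=
        mul_le_mul_of_nonneg_right this (binetKernel_nonneg t)
    _ = _ := by ring

/-- The leading terms of Stirling's formula on the positive real axis. -/
def realLeadingTerms (x : ℝ) : ℝ :=
  (x - 1 / 2) * Real.log x - x + 1 / 2 * Real.log (2 * Real.pi)

lemma convexOn_realLeadingTerms : ConvexOn ℝ (Ioi 0) realLeadingTerms := by
  have h1 : ConvexOn ℝ (Ioi 0) fun x : ℝ => x * Real.log x :=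
    Real.convexOn_mul_log.subset Ioi_subset_Ici_self (convex_Ioi 0)
  have h2 : ConvexOn ℝ (Ioi 0) fun x : ℝ => (1 / 2 : ℝ) • (-Real.log x) :=
    (strictConcaveOn_log_Ioi.concaveOn.neg).smul (by norm_num)
  have h3 : ConvexOn ℝ (Ioi 0) fun x : ℝ => -x := by
    exact (concaveOn_id (𝕜 := ℝ) (convex_Ioi (0 : ℝ))).neg
  refine (((h1.add h2).add h3).add_const (1 / 2 * Real.log (2 * Real.pi))).congr fun x _ => ?_
  simp [realLeadingTerms]; ring

/-- The limit √π of `stirlingSeq`, read at n + 1, supplies the constant (1/2) ln(2π). -/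
lemma tendsto_log_factorial_sub_realLeadingTerms :
    Tendsto (fun n : ℕ => Real.log (n.factorial) - realLeadingTerms ((n : ℝ) + 1)) atTop (𝓝 0) := by
  have hpi := Real.pi_pos
  have h1 := (Stirling.tendsto_stirlingSeq_sqrt_pi.log (by positivity)).comp (tendsto_add_atTop_nat 1)
  rw [Real.log_sqrt hpi.le] at h1
  have h2 := h1.sub_const (Real.log Real.pi / 2)
  rw [sub_self] at h2
  refine h2.congr fun n => ?_
  simp only [Function.comp_apply]
  rw [Stirling.stirlingSeq, Real.log_div (by positivity) (by positivity),
    Real.log_mul (by positivity) (by positivity), Real.log_pow,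
    Real.log_div (by positivity) (Real.exp_pos 1).ne', Real.log_exp, Real.log_sqrt (by positivity),
    Nat.factorial_succ, Nat.cast_mul, Real.log_mul (by positivity) (by positivity),
    realLeadingTerms, Real.log_mul two_ne_zero (by positivity),
    Real.log_mul two_ne_zero (by positivity)]
  push_cast
  ring

/-- Binet's formula on the positive real axis. -/
theorem log_Gamma_eq_add_binetIntegral {x : ℝ} (hx : 0 < x) :
    Real.log (Real.Gamma x) = realLeadingTerms x + binetIntegral x := by
  set f : ℝ → ℝ := fun x => realLeadingTerms x + binetIntegral x with hf
  have hconv : ConvexOn ℝ (Ioi 0) f := convexOn_realLeadingTerms.add convexOn_binetIntegral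
  have hfeq : ∀ {y : ℝ}, 0 < y → f (y + 1) = f y + Real.log y := by
    intro y hy
    have := binetIntegral_sub hy
    simp only [hf, realLeadingTerms]
    linarith
  -- The Bohr–Mollerup sequence tends to f(x) - f(1) and also to ln Γ(x); only f(1) = 0 remains.
  have h1 := tendsto_nhds_unique (Real.BohrMollerup.tendsto_logGammaSeq hconv hfeq hx)
    (Real.BohrMollerup.tendsto_log_gamma hx)
  -- The functional equation gives f(n+1) - ln n! = f(1) for all n, while Stirling's formula sends
  -- this difference to 0.
  have hone : f 1 = 0 := by
    have h2 : Tendsto (fun n : ℕ => f ((n + 1 : ℕ) : ℝ) -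
        Real.log (n.factorial)) atTop (𝓝 0) := by
      have h3 := (tendsto_binetIntegral.comp tendsto_natCast_atTop_atTop).comp
        (tendsto_add_atTop_nat 1)
      have h4 := h3.sub tendsto_log_factorial_sub_realLeadingTerms
      rw [sub_self] at h4
      refine h4.congr fun n => ?_
      simp only [hf, Function.comp_apply]
      push_cast
      ring
    refine tendsto_nhds_unique (tendsto_const_nhds.congr fun n => ?_) h2
    rw [Real.BohrMollerup.f_nat_eq hfeq n.succ_ne_zero]
    simp
  change _ = f x
  linarith

/-! ### Bounds for 1/sin and Γ on vertical lines. -/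

lemma norm_sin_vertical_ge (a b : ℝ) :
    |Real.sin a| ≤ ‖Complex.sin (a + b * Complex.I)‖ ∧
      |Real.sinh b| ≤ ‖Complex.sin (a + b * Complex.I)‖ := by
  have h : ‖Complex.sin (a + b * Complex.I)‖ ^ 2 = Real.sin a ^ 2 + Real.sinh b ^ 2 := by
    rw [Complex.sin_add_mul_I, ← Complex.ofReal_sin, ← Complex.ofReal_cos, ← Complex.ofReal_sinh,
      ← Complex.ofReal_cosh, ← Complex.ofReal_mul, ← Complex.ofReal_mul, Complex.sq_norm,
      Complex.normSq_add_mul_I]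
    have h1 := Real.cosh_sq b
    have h2 := Real.sin_sq_add_cos_sq a
    linear_combination Real.sin a ^ 2 * h1 + Real.sinh b ^ 2 * h2
  constructor
  · exact abs_le_of_sq_le_sq (by linarith [sq_nonneg (Real.sinh b)]) (norm_nonneg _)
  · exact abs_le_of_sq_le_sq (by linarith [sq_nonneg (Real.sin a)]) (norm_nonneg _)

lemma exists_norm_sin_vertical_bound {c : ℝ} (hc : Real.sin (Real.pi * c) ≠ 0) :
    ∃ C : ℝ, 0 < C ∧ ∀ τ : ℝ,
      ‖(Complex.sin (Real.pi * (c + τ * Complex.I)))⁻¹‖ ≤ C * Real.exp (-Real.pi * |τ|) := by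
  have hpi := Real.pi_pos
  have hs : 0 < |Real.sin (Real.pi * c)| := abs_pos.mpr hc
  -- From e^{π|τ|} ≤ 2|sinh πτ| + 1: the 2 pays for the sinh and 1/|sin πc| for the 1.
  refine ⟨2 + 1 / |Real.sin (Real.pi * c)|, by positivity, fun τ => ?_⟩
  have h := norm_sin_vertical_ge (Real.pi * c) (Real.pi * τ)
  have e : (Real.pi : ℂ) * (c + τ * Complex.I) =
      ((Real.pi * c : ℝ) : ℂ) + ((Real.pi * τ : ℝ) : ℂ) * Complex.I := by push_cast; ring
  rw [e, norm_inv]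
  set S := ‖Complex.sin (((Real.pi * c : ℝ) : ℂ) + ((Real.pi * τ : ℝ) : ℂ) * Complex.I)‖
  have hS : 0 < S := hs.trans_le h.1
  have hexp : Real.exp (Real.pi * |τ|) ≤ 2 * |Real.sinh (Real.pi * τ)| + 1 := by
    have : |Real.sinh (Real.pi * τ)| = Real.sinh (Real.pi * |τ|) := by
      rw [Real.abs_sinh, abs_mul, abs_of_pos hpi]
    rw [this, Real.sinh_eq]
    have : Real.exp (-(Real.pi * |τ|)) ≤ 1 := Real.exp_le_one_iff.mpr (by
      have := abs_nonneg τ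
      nlinarith)
    linarith
  have h1 : 1 ≤ 1 / |Real.sin (Real.pi * c)| * S := by
    rw [div_mul_eq_mul_div, one_mul, le_div_iff₀ hs, one_mul]; exact h.1
  rw [neg_mul, Real.exp_neg, ← div_eq_mul_inv, inv_eq_one_div, div_le_div_iff₀ hS (Real.exp_pos _)]
  nlinarith [h.2]

/-- In Euler's product, |Γ(σ+iτ)|/Γ(σ) has the factors (σ+j)/|σ+j+iτ|, which increase with σ. This
carries decay from a line Re s = m to every line between it and the imaginary axis. -/
lemma norm_Gamma_mul_Gamma_le {σ m : ℝ} (hσ : 0 < σ) (hm : σ ≤ m) (τ : ℝ) :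
    ‖Complex.Gamma (σ + τ * Complex.I)‖ * Real.Gamma m ≤
      Real.Gamma σ * ‖Complex.Gamma (m + τ * Complex.I)‖ := by
  have hm0 : 0 < m := hσ.trans_le hm
  refine le_of_tendsto_of_tendsto
    ((Complex.GammaSeq_tendsto_Gamma _).norm.mul (Real.GammaSeq_tendsto_Gamma m))
    ((Real.GammaSeq_tendsto_Gamma σ).mul (Complex.GammaSeq_tendsto_Gamma _).norm) ?_
  filter_upwards [eventually_gt_atTop 0] with n hn
  have hn' : (0 : ℝ) < n := by exact_mod_cast hn
  have hnorm : ∀ u : ℝ, ‖Complex.GammaSeq (u + τ * Complex.I) n‖ =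
      (n : ℝ) ^ u * n.factorial / ∏ j ∈ Finset.range (n + 1), ‖(u + τ * Complex.I + j : ℂ)‖ := by
    intro u
    rw [Complex.GammaSeq, norm_div, norm_mul, norm_prod, Complex.norm_natCast,
      ← Complex.ofReal_natCast n, Complex.norm_cpow_eq_rpow_re_of_pos hn']
    simp
  have hpos : ∀ u : ℝ, 0 < u → 0 < ∏ j ∈ Finset.range (n + 1), ‖(u + τ * Complex.I + j : ℂ)‖ := by
    intro u hu
    refine Finset.prod_pos fun j _ => norm_pos_iff.mpr fun h => ?_
    have := congrArg Complex.re h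
    simp at this
    have : (0 : ℝ) ≤ j := j.cast_nonneg
    linarith
  have hpos' : ∀ u : ℝ, 0 < u → 0 < ∏ j ∈ Finset.range (n + 1), (u + j) := fun u hu =>
    Finset.prod_pos fun j _ => by positivity
  rw [hnorm, hnorm, Real.GammaSeq, Real.GammaSeq, div_mul_div_comm, div_mul_div_comm,
    div_le_div_iff₀ (mul_pos (hpos σ hσ) (hpos' m hm0)) (mul_pos (hpos' σ hσ) (hpos m hm0))]
  have key : (∏ j ∈ Finset.range (n + 1), (σ + j)) *
      ∏ j ∈ Finset.range (n + 1), ‖(m + τ * Complex.I + j : ℂ)‖ ≤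
      (∏ j ∈ Finset.range (n + 1), ‖(σ + τ * Complex.I + j : ℂ)‖) *
      ∏ j ∈ Finset.range (n + 1), (m + j) := by
    rw [← Finset.prod_mul_distrib, ← Finset.prod_mul_distrib]
    refine Finset.prod_le_prod (fun j _ => by positivity) fun j _ => ?_
    have hj : (0 : ℝ) ≤ j := j.cast_nonneg
    have hsq : ∀ u : ℝ, ‖(u + τ * Complex.I + j : ℂ)‖ ^ 2 = (u + j) ^ 2 + τ ^ 2 := by
      intro u
      rw [show (u + τ * Complex.I + j : ℂ) = ((u + j : ℝ) : ℂ) + (τ : ℂ) * Complex.I by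
        push_cast; ring, Complex.sq_norm, Complex.normSq_add_mul_I]
    refine le_of_sq_le_sq ?_ (by positivity) |> fun h => h
    rw [mul_pow, mul_pow, hsq, hsq]
    have : (σ + j) ^ 2 ≤ (m + j) ^ 2 := by gcongr
    nlinarith [sq_nonneg τ]
  have hc : 0 ≤ (n : ℝ) ^ σ * n.factorial * ((n : ℝ) ^ m * n.factorial) := by positivity
  calc _ = (n : ℝ) ^ σ * n.factorial * ((n : ℝ) ^ m * n.factorial) *
        ((∏ j ∈ Finset.range (n + 1), (σ + j)) *
          ∏ j ∈ Finset.range (n + 1), ‖(m + τ * Complex.I + j : ℂ)‖) := by ring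
    _ ≤ _ := mul_le_mul_of_nonneg_left key hc

/-- On Re s = 1/2 one has 1 - s = conj s, so the reflection formula reads |Γ(s)|² = π/|sin πs|. -/
lemma exists_norm_Gamma_half_bound : ∃ C : ℝ, 0 < C ∧ ∀ τ : ℝ,
    ‖Complex.Gamma ((1 / 2 : ℝ) + τ * Complex.I)‖ ≤ C * Real.exp (-(Real.pi / 2) * |τ|) := by
  obtain ⟨C, hC, h⟩ := exists_norm_sin_vertical_bound (c := 1 / 2)
    (by rw [mul_one_div, Real.sin_pi_div_two]; exact one_ne_zero)
  refine ⟨√(Real.pi * C), by have := Real.pi_pos; positivity, fun τ => ?_⟩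
  have h1 := Complex.Gamma_mul_Gamma_one_sub ((1 / 2 : ℝ) + τ * Complex.I)
  have h2 : 1 - (((1 / 2 : ℝ) : ℂ) + τ * Complex.I) =
      (starRingEnd ℂ) (((1 / 2 : ℝ) : ℂ) + τ * Complex.I) := by
    rw [map_add, map_mul, Complex.conj_ofReal, Complex.conj_ofReal, Complex.conj_I]
    push_cast
    ring
  rw [h2, Complex.Gamma_conj] at h1
  have h3 := congrArg norm h1
  rw [norm_mul, RCLike.norm_conj, norm_div, Complex.norm_real,
    Real.norm_of_nonneg Real.pi_pos.le] at h3
  have hsq : ‖Complex.Gamma ((1 / 2 : ℝ) + τ * Complex.I)‖ ^ 2 ≤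
      Real.pi * (C * Real.exp (-Real.pi * |τ|)) := by
    rw [sq, h3, div_eq_mul_inv Real.pi, ← norm_inv]
    exact mul_le_mul_of_nonneg_left (h τ) Real.pi_pos.le
  calc _ ≤ √(Real.pi * (C * Real.exp (-Real.pi * |τ|))) := Real.le_sqrt_of_sq_le hsq
    _ = _ := by
      rw [← mul_assoc, Real.sqrt_mul (by have := Real.pi_pos; positivity), ← Real.exp_half]
      congr 2
      ring

lemma exists_norm_Gamma_add_half_bound (k : ℕ) : ∃ C : ℝ, 0 < C ∧ ∀ τ : ℝ,
    ‖Complex.Gamma ((k + 1 / 2 : ℝ) + τ * Complex.I)‖ ≤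
      C * (1 + |τ|) ^ k * Real.exp (-(Real.pi / 2) * |τ|) := by
  induction k with
  | zero => simpa using exists_norm_Gamma_half_bound
  | succ k ih =>
    obtain ⟨C, hC, h⟩ := ih
    refine ⟨(k + 1) * C, by positivity, fun τ => ?_⟩
    have hne : (((k + 1 / 2 : ℝ) : ℂ) + τ * Complex.I) ≠ 0 := by
      intro h0
      have := congrArg Complex.re h0
      simp at this
      have : (0 : ℝ) ≤ k := k.cast_nonneg
      linarith
    rw [show ((((k + 1 : ℕ) : ℝ) + 1 / 2 : ℝ) : ℂ) + τ * Complex.I =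
      ((k + 1 / 2 : ℝ) : ℂ) + τ * Complex.I + 1 by push_cast; ring,
      Complex.Gamma_add_one _ hne, norm_mul]
    have h1 : ‖(((k + 1 / 2 : ℝ) : ℂ) + τ * Complex.I)‖ ≤ (k + 1) * (1 + |τ|) := by
      calc _ ≤ ‖((k + 1 / 2 : ℝ) : ℂ)‖ + ‖(τ : ℂ) * Complex.I‖ := norm_add_le _ _
        _ = (k + 1 / 2) + |τ| := by
          rw [norm_mul, Complex.norm_I, mul_one, Complex.norm_real, Complex.norm_real,
            Real.norm_eq_abs, Real.norm_eq_abs, abs_of_nonneg (by positivity)]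
        _ ≤ _ := by
          have := abs_nonneg τ
          have : (0 : ℝ) ≤ k := k.cast_nonneg
          nlinarith
    calc _ ≤ ((k + 1) * (1 + |τ|)) * (C * (1 + |τ|) ^ k * Real.exp (-(Real.pi / 2) * |τ|)) :=
          mul_le_mul h1 (h τ) (norm_nonneg _) (by positivity)
      _ = _ := by ring

/-- Absorbs polynomial factors into an arbitrarily slow exponential. -/
lemma one_add_le_mul_exp {δ : ℝ} (hδ : 0 < δ) {y : ℝ} (hy : 0 ≤ y) :
    1 + y ≤ (1 + 1 / δ) * Real.exp (δ * y) := by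
  have h1 : 1 ≤ Real.exp (δ * y) := Real.one_le_exp (by positivity)
  have h2 : y ≤ 1 / δ * Real.exp (δ * y) := by
    rw [div_mul_eq_mul_div, one_mul, le_div_iff₀ hδ]
    have := Real.add_one_le_exp (δ * y)
    linarith
  linarith

/-- Exponential decay of the Gamma function on vertical lines. -/
lemma exists_norm_Gamma_vertical_bound {σ α : ℝ} (hσ : 0 < σ) (hα : α < Real.pi / 2) :
    ∃ C : ℝ, 0 < C ∧ ∀ τ : ℝ,
      ‖Complex.Gamma (σ + τ * Complex.I)‖ ≤ C * Real.exp (-α * |τ|) := by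
  obtain ⟨k, hk⟩ := exists_nat_ge σ
  obtain ⟨C, hC, h⟩ := exists_norm_Gamma_add_half_bound k
  set m : ℝ := k + 1 / 2 with hm
  have hσm : σ ≤ m := by linarith
  -- The k linear factors then cost at most e^{(π/2-α)|τ|} in total; k + 1 keeps the denominator
  -- positive.
  set δ := (Real.pi / 2 - α) / (k + 1) with hδ
  have hδ0 : 0 < δ := div_pos (by linarith) (by positivity)
  have hG : 0 < Real.Gamma m := Real.Gamma_pos_of_pos (hσ.trans_le hσm)
  have hGσ : 0 < Real.Gamma σ := Real.Gamma_pos_of_pos hσ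
  refine ⟨Real.Gamma σ / Real.Gamma m * (C * (1 + 1 / δ) ^ k), by positivity, fun τ => ?_⟩
  have h1 := norm_Gamma_mul_Gamma_le hσ hσm τ
  have h2 : ‖Complex.Gamma (σ + τ * Complex.I)‖ ≤
      Real.Gamma σ / Real.Gamma m * ‖Complex.Gamma (m + τ * Complex.I)‖ := by
    rw [div_mul_eq_mul_div, le_div_iff₀ hG]; exact h1
  have hp : (1 + |τ|) ^ k ≤ (1 + 1 / δ) ^ k * Real.exp ((Real.pi / 2 - α) * |τ|) := by
    calc (1 + |τ|) ^ k ≤ ((1 + 1 / δ) * Real.exp (δ * |τ|)) ^ k :=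
          pow_le_pow_left₀ (by positivity) (one_add_le_mul_exp hδ0 (abs_nonneg τ)) k
      _ = (1 + 1 / δ) ^ k * Real.exp (k * (δ * |τ|)) := by rw [mul_pow, ← Real.exp_nat_mul]
      _ ≤ _ := by
        have hkδ : k * δ ≤ Real.pi / 2 - α := by
          rw [hδ, mul_div_assoc', div_le_iff₀ (by positivity)]
          nlinarith
        rw [← mul_assoc]
        gcongr
  calc _ ≤ _ := h2
    _ ≤ Real.Gamma σ / Real.Gamma m * (C * (1 + |τ|) ^ k * Real.exp (-(Real.pi / 2) * |τ|)) :=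
      mul_le_mul_of_nonneg_left (h τ) (by positivity)
    _ ≤ Real.Gamma σ / Real.Gamma m * (C * ((1 + 1 / δ) ^ k *
        Real.exp ((Real.pi / 2 - α) * |τ|)) * Real.exp (-(Real.pi / 2) * |τ|)) := by gcongr
    _ = _ := by
      rw [show -α * |τ| = (Real.pi / 2 - α) * |τ| + -(Real.pi / 2) * |τ| by ring, Real.exp_add]
      ring

/-! ### Convergence and holomorphy of the line integrals. -/

lemma sin_pi_mul_ne_zero_of_mem_Ioo {N : ℕ} {c : ℝ} (h1 : (N : ℝ) - 1 < c) (h2 : c < N) :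
    Real.sin (Real.pi * c) ≠ 0 := by
  rw [Real.sin_ne_zero_iff]
  intro n hn
  rw [mul_comm] at hn
  have hn := mul_left_cancel₀ Real.pi_ne_zero hn
  rw [← hn] at h1 h2
  have h1' : (N : ℤ) - 1 < n := by exact_mod_cast h1
  have h2' : n < (N : ℤ) := by exact_mod_cast h2
  omega

/-- The factor `Γ(2s-1) / sin(πs)` of the Mellin-Barnes integrand. -/
def gammaDivSin (s : ℂ) : ℂ := Complex.Gamma (2 * s - 1) * (Complex.sin (Real.pi * s))⁻¹

lemma two_mul_vertical_sub_one (c τ : ℝ) : 2 * ((c : ℂ) + τ * Complex.I) - 1 =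
    ((2 * c - 1 : ℝ) : ℂ) + ((2 * τ : ℝ) : ℂ) * Complex.I := by push_cast; ring

lemma sin_pi_mul_vertical_ne_zero {c : ℝ} (hc : Real.sin (Real.pi * c) ≠ 0) (τ : ℝ) :
    Complex.sin (Real.pi * (c + τ * Complex.I)) ≠ 0 := by
  have h := (norm_sin_vertical_ge (Real.pi * c) (Real.pi * τ)).1
  intro h0
  rw [show ((Real.pi * c : ℝ) : ℂ) + ((Real.pi * τ : ℝ) : ℂ) * Complex.I =
    Real.pi * (c + τ * Complex.I) by push_cast; ring, h0, norm_zero] at h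
  exact hc (abs_eq_zero.mp (le_antisymm h (abs_nonneg _)))

lemma continuous_gammaDivSin_vertical {c : ℝ} (hc : 1 / 2 < c)
    (hs : Real.sin (Real.pi * c) ≠ 0) :
    Continuous fun τ : ℝ => gammaDivSin (c + τ * Complex.I) := by
  refine Continuous.mul ?_ ?_
  · rw [continuous_iff_continuousAt]
    intro τ
    refine ContinuousAt.comp (g := Complex.Gamma)
      (f := fun τ : ℝ => 2 * ((c : ℂ) + τ * Complex.I) - 1) ?_ (by fun_prop)
    refine (Complex.differentiableAt_Gamma _ fun m h => ?_).continuousAt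
    have := congrArg Complex.re h
    simp at this
    have : (0 : ℝ) ≤ m := m.cast_nonneg
    linarith
  · refine Continuous.inv₀ ?_ (sin_pi_mul_vertical_ne_zero hs)
    exact Complex.continuous_sin.comp (by fun_prop)

/-- 1/sin(πs) decays like e^{-π|τ|}. Γ(2s-1) has imaginary part 2τ in its argument and so reaches
every rate below π; α below solves 2α + π = β. -/
lemma exists_norm_gammaDivSin_bound {c β : ℝ} (hc : 1 / 2 < c)
    (hs : Real.sin (Real.pi * c) ≠ 0) (hβ : β < 2 * Real.pi) :
    ∃ C : ℝ, 0 < C ∧ ∀ τ : ℝ,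
      ‖gammaDivSin (c + τ * Complex.I)‖ ≤ C * Real.exp (-β * |τ|) := by
  obtain ⟨C₁, hC₁, h₁⟩ := exists_norm_Gamma_vertical_bound (σ := 2 * c - 1)
    (α := (β - Real.pi) / 2) (by linarith) (by linarith)
  obtain ⟨C₂, hC₂, h₂⟩ := exists_norm_sin_vertical_bound hs
  refine ⟨C₁ * C₂, by positivity, fun τ => ?_⟩
  rw [gammaDivSin, norm_mul, two_mul_vertical_sub_one]
  calc _ ≤ (C₁ * Real.exp (-((β - Real.pi) / 2) * |2 * τ|)) *
        (C₂ * Real.exp (-Real.pi * |τ|)) :=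
        mul_le_mul (h₁ _) (h₂ τ) (norm_nonneg _) (by positivity)
    _ = _ := by
      rw [abs_mul, abs_two, show -β * |τ| = -((β - Real.pi) / 2) * (2 * |τ|) + -Real.pi * |τ| by
        ring, Real.exp_add]
      ring

lemma integrable_exp_neg_mul_abs {δ : ℝ} (hδ : 0 < δ) :
    Integrable fun τ : ℝ => Real.exp (-δ * |τ|) := by
  rw [← integrableOn_univ, ← Iic_union_Ioi (a := (0 : ℝ))]
  refine IntegrableOn.union ?_ ?_
  · refine (integrableOn_exp_mul_Iic hδ 0).congr_fun (fun τ hτ => ?_) measurableSet_Iic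
    simp only [abs_of_nonpos (mem_Iic.mp hτ), neg_mul_neg]
  · refine (integrableOn_exp_neg_mul hδ).congr_fun (fun τ hτ => ?_) measurableSet_Ioi
    simp only [abs_of_pos (mem_Ioi.mp hτ)]

lemma norm_exp_vertical (c τ : ℝ) (l : ℂ) :
    ‖Complex.exp (-2 * ((c : ℂ) + τ * Complex.I) * l)‖ =
      Real.exp (-2 * c * l.re + 2 * τ * l.im) := by
  rw [Complex.norm_exp]; congr 1; simp; ring

lemma integrable_exp_mul_of_decay {H : ℝ → ℂ} (hH : Continuous H)
    (hdecay : ∀ β < 2 * Real.pi, ∃ C : ℝ, 0 < C ∧ ∀ τ : ℝ, ‖H τ‖ ≤ C * Real.exp (-β * |τ|))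
    (c : ℝ) {l : ℂ} (hl : |l.im| < Real.pi) :
    Integrable fun τ : ℝ => Complex.exp (-2 * ((c : ℂ) + τ * Complex.I) * l) * H τ := by
  -- The exponential grows at rate at most 2|Im l|; this β lies halfway between that and 2π.
  obtain ⟨C, hC, h⟩ := hdecay (|l.im| + Real.pi) (by linarith)
  refine ((integrable_exp_neg_mul_abs (δ := Real.pi - |l.im|) (by linarith)).const_mul
    (Real.exp (-2 * c * l.re) * C)).mono' (by fun_prop : Continuous _).aestronglyMeasurable ?_
  filter_upwards with τ
  rw [norm_mul, norm_exp_vertical]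
  have hτ : τ * l.im ≤ |τ| * |l.im| := by rw [← abs_mul]; exact le_abs_self _
  calc _ ≤ Real.exp (-2 * c * l.re + 2 * (|τ| * |l.im|)) *
        (C * Real.exp (-(|l.im| + Real.pi) * |τ|)) := by
        refine mul_le_mul (Real.exp_le_exp.mpr ?_) (h τ) (norm_nonneg _) (by positivity)
        linarith
    _ = _ := by
      rw [show -(Real.pi - |l.im|) * |τ| = 2 * (|τ| * |l.im|) + -(|l.im| + Real.pi) * |τ| by ring,
        Real.exp_add, Real.exp_add]
      ring

/-- The integral `∫ e^{-2sl} H(τ) dτ`, `s = c + iτ`, is holomorphic for `|Im l| < π` when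
`H(τ) = O(e^{-β|τ|})` for all `β < 2π`. -/
lemma differentiableAt_integral_exp_mul {H : ℝ → ℂ} (hH : Continuous H)
    (hdecay : ∀ β < 2 * Real.pi, ∃ C : ℝ, 0 < C ∧ ∀ τ : ℝ, ‖H τ‖ ≤ C * Real.exp (-β * |τ|))
    (c : ℝ) {l₀ : ℂ} (hl : |l₀.im| < Real.pi) :
    DifferentiableAt ℂ
      (fun l : ℂ => ∫ τ : ℝ, Complex.exp (-2 * ((c : ℂ) + τ * Complex.I) * l) * H τ) l₀ := by
  -- On the ball of radius ρ one has |Im l| ≤ v. The decay rate v + π beats the growth rate 2v by π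
  -- - v = 2δ: one δ absorbs the factor s from differentiation, the other keeps the bound
  -- integrable.
  set v := (|l₀.im| + Real.pi) / 2 with hv
  have hv0 : |l₀.im| < v := by rw [hv]; linarith
  have hvπ : v < Real.pi := by rw [hv]; linarith
  obtain ⟨C, hC, h⟩ := hdecay (v + Real.pi) (by linarith)
  set ρ := v - |l₀.im| with hρ
  have hρ0 : 0 < ρ := by linarith
  set δ := (Real.pi - v) / 2 with hδ
  have hδ0 : 0 < δ := by rw [hδ]; linarith
  set D := 2 * (|c| + 1) * Real.exp (2 * |c| * (|l₀.re| + ρ)) * C * (1 + 1 / δ) with hD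
  refine (hasDerivAt_integral_of_dominated_loc_of_deriv_le
    (F := fun l τ => Complex.exp (-2 * ((c : ℂ) + τ * Complex.I) * l) * H τ)
    (F' := fun l τ => -2 * ((c : ℂ) + τ * Complex.I) *
      Complex.exp (-2 * ((c : ℂ) + τ * Complex.I) * l) * H τ)
    (bound := fun τ => D * Real.exp (-δ * |τ|)) (Metric.ball_mem_nhds l₀ hρ0)
    (Eventually.of_forall fun l => (by fun_prop : Continuous _).aestronglyMeasurable)
    (integrable_exp_mul_of_decay hH hdecay c hl)
    (by fun_prop : Continuous _).aestronglyMeasurable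
    (Eventually.of_forall fun τ l hlb => ?_) ((integrable_exp_neg_mul_abs hδ0).const_mul D)
    (Eventually.of_forall fun τ l _ => ?_)).2.differentiableAt
  · have hdist : ‖l - l₀‖ < ρ := by simpa [dist_eq_norm] using hlb
    have hre : |l.re| ≤ |l₀.re| + ρ := by
      have h1 := (Complex.abs_re_le_norm (l - l₀)).trans hdist.le
      rw [Complex.sub_re] at h1
      have := abs_sub_abs_le_abs_sub l.re l₀.re
      linarith
    have him : |l.im| ≤ v := by
      have h1 := (Complex.abs_im_le_norm (l - l₀)).trans hdist.le
      rw [Complex.sub_im] at h1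
      have := abs_sub_abs_le_abs_sub l.im l₀.im
      linarith
    have hs : ‖-2 * ((c : ℂ) + τ * Complex.I)‖ ≤ 2 * (|c| + 1) * (1 + |τ|) := by
      rw [norm_mul, norm_neg, Complex.norm_ofNat]
      have : ‖(c : ℂ) + τ * Complex.I‖ ≤ |c| + |τ| := by
        refine (norm_add_le _ _).trans ?_
        simp
      nlinarith [abs_nonneg c, abs_nonneg τ, mul_nonneg (abs_nonneg c) (abs_nonneg τ)]
    have he : ‖Complex.exp (-2 * ((c : ℂ) + τ * Complex.I) * l)‖ ≤
        Real.exp (2 * |c| * (|l₀.re| + ρ)) * Real.exp (2 * v * |τ|) := by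
      rw [norm_exp_vertical, ← Real.exp_add]
      apply Real.exp_le_exp.mpr
      have h1 : -(c * l.re) ≤ |c| * (|l₀.re| + ρ) := by
        refine (neg_le_abs _).trans ?_
        rw [abs_mul]
        gcongr
      have h2 : τ * l.im ≤ |τ| * v := by
        refine (le_abs_self _).trans ?_
        rw [abs_mul]
        gcongr
      linarith
    have hp := one_add_le_mul_exp hδ0 (abs_nonneg τ)
    rw [norm_mul, norm_mul]
    calc _ ≤ (2 * (|c| + 1) * ((1 + 1 / δ) * Real.exp (δ * |τ|))) *
          (Real.exp (2 * |c| * (|l₀.re| + ρ)) * Real.exp (2 * v * |τ|)) *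
          (C * Real.exp (-(v + Real.pi) * |τ|)) := by
          refine mul_le_mul (mul_le_mul (hs.trans ?_) he (norm_nonneg _) (by positivity)) (h τ)
            (norm_nonneg _) (by positivity)
          gcongr
      _ = D * (Real.exp (δ * |τ|) * Real.exp (2 * v * |τ|) *
          Real.exp (-(v + Real.pi) * |τ|)) := by rw [hD]; ring
      _ = _ := by
        rw [← Real.exp_add, ← Real.exp_add]
        congr 2
        rw [hδ]; ring
  · have := ((hasDerivAt_id l).const_mul (-2 * ((c : ℂ) + τ * Complex.I))).cexp.mul_const (H τ)
    refine this.congr_deriv ?_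
    simp only [id, mul_one]
    ring

/-! ### The Mellin pair 1/(1+w) and π/sin(πs). -/

lemma mellinConvergent_one_div_one_add {s : ℂ} (h0 : 0 < s.re) (h1 : s.re < 1) :
    MellinConvergent (fun w : ℝ => (1 / (1 + w) : ℂ)) s := by
  have hne : ∀ w ∈ Ioi (0 : ℝ), (1 + w : ℂ) ≠ 0 := by
    intro w hw h
    have := congrArg Complex.re h
    simp at this
    linarith [mem_Ioi.mp hw]
  have hnorm : ∀ w : ℝ, 0 < w → ‖(1 / (1 + w) : ℂ)‖ = 1 / (1 + w) := by
    intro w hw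
    rw [show (1 / (1 + w) : ℂ) = ((1 / (1 + w) : ℝ) : ℂ) by push_cast; rfl, Complex.norm_real,
      Real.norm_of_nonneg (by positivity)]
  refine mellinConvergent_of_isBigO_rpow (a := 1) (b := 0) ?_ ?_ h1 ?_ h0
  · refine ContinuousOn.locallyIntegrableOn ?_ measurableSet_Ioi
    exact continuousOn_const.div (by fun_prop) hne
  · refine Asymptotics.IsBigO.of_bound 1 ?_
    filter_upwards [eventually_gt_atTop 0] with w hw
    rw [hnorm w hw, Real.rpow_neg_one, Real.norm_of_nonneg (by positivity), one_mul, ← one_div]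
    gcongr
    linarith
  · refine Asymptotics.IsBigO.of_bound 1 ?_
    filter_upwards [self_mem_nhdsWithin] with w hw
    have hw : 0 < w := hw
    rw [hnorm w hw, neg_zero, Real.rpow_zero, norm_one, one_mul, div_le_one (by positivity)]
    linarith

lemma integral_exp_neg_mul_ofReal {x : ℝ} (hx : 0 < x) :
    ∫ t in Ioi (0 : ℝ), Complex.exp (-(x * t)) = 1 / x := by
  have h := congrArg (fun y : ℝ => (y : ℂ)) (integral_exp_neg_mul hx)
  simp only [← integral_complex_ofReal] at h
  push_cast at h
  simpa only [neg_mul] using h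

lemma integrableOn_exp_neg_mul_ofReal {x : ℝ} (hx : 0 < x) :
    IntegrableOn (fun t : ℝ => Complex.exp (-(x * t))) (Ioi 0) := by
  refine Integrable.congr (integrableOn_exp_neg_mul hx).ofReal (Eventually.of_forall fun t => ?_)
  simp

/-- The Mellin transform of `1 / (1 + w)` is `π / sin(πs)`. -/
lemma mellin_one_div_one_add {s : ℂ} (h0 : 0 < s.re) (h1 : s.re < 1) :
    mellin (fun w : ℝ => (1 / (1 + w) : ℂ)) s = Real.pi / Complex.sin (Real.pi * s) := by
  rw [← Complex.Gamma_mul_Gamma_one_sub, mellin]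
  -- With 1/(1+w) = ∫ e^{-(1+w)v} dv, swapping the integrals separates the transform into Γ(s)
  -- Γ(1-s).
  have hinner : ∀ w ∈ Ioi (0 : ℝ), (w : ℂ) ^ (s - 1) • (1 / (1 + w) : ℂ) =
      ∫ v in Ioi (0 : ℝ), (w : ℂ) ^ (s - 1) * Complex.exp (-((1 + w : ℝ) * v)) := by
    intro w hw
    have hw : 0 < w := hw
    rw [integral_const_mul, integral_exp_neg_mul_ofReal (by positivity), smul_eq_mul]
    push_cast
    rfl
  have hmeas : Measurable fun p : ℝ × ℝ =>
      (p.1 : ℂ) ^ (s - 1) * Complex.exp (-((1 + p.1 : ℝ) * p.2)) := by fun_prop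
  have hint : Integrable (fun p : ℝ × ℝ =>
      (p.1 : ℂ) ^ (s - 1) * Complex.exp (-((1 + p.1 : ℝ) * p.2)))
      ((volume.restrict (Ioi 0)).prod (volume.restrict (Ioi 0))) := by
    rw [integrable_prod_iff hmeas.aestronglyMeasurable]
    constructor
    · refine (ae_restrict_mem measurableSet_Ioi).mono fun w hw => ?_
      have hw : 0 < w := hw
      exact (integrableOn_exp_neg_mul_ofReal (by positivity : 0 < 1 + w)).const_mul ((w : ℂ) ^ (s - 1))
    · refine (mellinConvergent_one_div_one_add h0 h1).norm.congr ?_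
      refine (ae_restrict_mem measurableSet_Ioi).mono fun w hw => ?_
      have hw : 0 < w := hw
      simp only [norm_mul, norm_smul]
      rw [integral_const_mul]
      congr 1
      have : ∀ v : ℝ, ‖Complex.exp (-((1 + w : ℝ) * v))‖ = Real.exp (-(1 + w) * v) := by
        intro v
        rw [Complex.norm_exp]; congr 1; simp; ring
      simp_rw [this]
      rw [integral_exp_neg_mul (by positivity),
        show (1 / (1 + w) : ℂ) = ((1 / (1 + w) : ℝ) : ℂ) by push_cast; rfl, Complex.norm_real,
        Real.norm_of_nonneg (by positivity)]
  rw [setIntegral_congr_fun measurableSet_Ioi hinner, integral_integral_swap hint]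
  have hv : ∀ v ∈ Ioi (0 : ℝ),
      ∫ w in Ioi (0 : ℝ), (w : ℂ) ^ (s - 1) * Complex.exp (-((1 + w : ℝ) * v)) =
      Complex.Gamma s * ((v : ℂ) ^ ((1 - s) - 1) * Complex.exp (-((1 : ℝ) * v))) := by
    intro v hv
    have hv : 0 < v := hv
    have : ∀ w : ℝ, (w : ℂ) ^ (s - 1) * Complex.exp (-((1 + w : ℝ) * v)) =
        Complex.exp (-((1 : ℝ) * v)) * ((w : ℂ) ^ (s - 1) * Complex.exp (-(v * w))) := by
      intro w
      rw [show (-((1 + w : ℝ) * v) : ℂ) = -((1 : ℝ) * v) + -(v * w) by push_cast; ring,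
        Complex.exp_add]
      ring
    simp_rw [this]
    rw [integral_const_mul, Complex.integral_cpow_mul_exp_neg_mul_Ioi h0 hv,
      show (1 - s) - 1 = -s by ring, Complex.cpow_neg, one_div, ← Complex.inv_cpow]
    · ring
    · rw [Complex.arg_ofReal_of_nonneg hv.le]; exact Real.pi_pos.ne
  rw [setIntegral_congr_fun measurableSet_Ioi hv, integral_const_mul,
    Complex.integral_cpow_mul_exp_neg_mul_Ioi (by simpa using h1) one_pos]
  simp

lemma integrable_inv_sin_vertical {c : ℝ} (hs : Real.sin (Real.pi * c) ≠ 0) :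
    Integrable fun τ : ℝ => (Complex.sin (Real.pi * (c + τ * Complex.I)))⁻¹ := by
  obtain ⟨C, _, h⟩ := exists_norm_sin_vertical_bound hs
  refine ((integrable_exp_neg_mul_abs Real.pi_pos).const_mul C).mono' ?_ (Eventually.of_forall h)
  have : Continuous fun τ : ℝ => (Complex.sin (Real.pi * (c + τ * Complex.I)))⁻¹ :=
    Continuous.inv₀ (Complex.continuous_sin.comp (by fun_prop)) (sin_pi_mul_vertical_ne_zero hs)
  exact this.aestronglyMeasurable

/-- The inversion formula for the Mellin transform of `1 / (1 + w)`. -/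
lemma integral_cpow_div_sin {c w : ℝ} (h0 : 0 < c) (h1 : c < 1) (hw : 0 < w) :
    ∫ τ : ℝ, (w : ℂ) ^ (-((c : ℂ) + τ * Complex.I)) *
      (Complex.sin (Real.pi * (c + τ * Complex.I)))⁻¹ = 2 / (1 + w) := by
  have hpi : (Real.pi : ℂ) ≠ 0 := by exact_mod_cast Real.pi_ne_zero
  have hs : Real.sin (Real.pi * c) ≠ 0 :=
    sin_pi_mul_ne_zero_of_mem_Ioo (N := 1) (by simpa using h0) (by simpa using h1)
  have hm : ∀ τ : ℝ, mellin (fun w : ℝ => (1 / (1 + w) : ℂ)) (c + τ * Complex.I) =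
      Real.pi * (Complex.sin (Real.pi * (c + τ * Complex.I)))⁻¹ := by
    intro τ
    rw [mellin_one_div_one_add (by simpa using h0) (by simpa using h1), div_eq_mul_inv]
  have hcont : ContinuousAt (fun w : ℝ => (1 / (1 + w) : ℂ)) w := by
    refine continuousAt_const.div (by fun_prop) fun h => ?_
    have := congrArg Complex.re h
    simp at this
    linarith
  have h := mellinInv_mellin_eq c (fun w : ℝ => (1 / (1 + w) : ℂ)) hw
    (mellinConvergent_one_div_one_add (by simpa using h0) (by simpa using h1))
    (by
      simp only [Complex.VerticalIntegrable, hm]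
      exact (integrable_inv_sin_vertical hs).const_mul _) hcont
  simp only [mellinInv, hm, smul_eq_mul] at h
  simp_rw [mul_left_comm _ (Real.pi : ℂ)] at h
  rw [integral_const_mul, Complex.real_smul] at h
  push_cast at h
  rw [← mul_assoc, show (1 / (2 * Real.pi) * Real.pi : ℂ) = 1 / 2 by field_simp] at h
  linear_combination 2 * h

/-- Translation by m brings the line into 0 < Re s < 1, where inversion applies with w = e^{2u};
antiperiodicity of sin yields (-1)^m. -/
lemma integral_exp_div_sin {m : ℕ} {c : ℝ} (h0 : (m : ℝ) < c) (h1 : c < m + 1) (u : ℝ) :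
    ∫ τ : ℝ, Complex.exp (-2 * ((c : ℂ) + τ * Complex.I) * u) *
      (Complex.sin (Real.pi * (c + τ * Complex.I)))⁻¹ =
      2 * (-1) ^ m * Complex.exp (-2 * m * u) / (1 + Complex.exp (2 * u)) := by
  have h := integral_cpow_div_sin (c := c - m) (w := Real.exp (2 * u)) (by linarith)
    (by linarith) (Real.exp_pos _)
  have hτ : ∀ τ : ℝ, Complex.exp (-2 * ((c : ℂ) + τ * Complex.I) * u) *
      (Complex.sin (Real.pi * (c + τ * Complex.I)))⁻¹ =
      (-1) ^ m * Complex.exp (-2 * m * u) *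
        (((Real.exp (2 * u) : ℝ) : ℂ) ^ (-(((c - m : ℝ) : ℂ) + τ * Complex.I)) *
      (Complex.sin (Real.pi * (((c - m : ℝ) : ℂ) + τ * Complex.I)))⁻¹) := by
    intro τ
    have e1 : (Real.pi * (c + τ * Complex.I) : ℂ) =
        Real.pi * (((c - m : ℝ) : ℂ) + τ * Complex.I) + m * Real.pi := by push_cast; ring
    rw [e1, Complex.sin_antiperiodic.add_nat_mul_eq, Complex.cpow_def_of_ne_zero (by
      exact_mod_cast (Real.exp_pos _).ne'), ← Complex.ofReal_log (Real.exp_pos _).le, Real.log_exp,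
      mul_inv, ← inv_pow, inv_neg_one,
      show (-2 * ((c : ℂ) + τ * Complex.I) * u) = -2 * m * u +
        ((2 * u : ℝ) : ℂ) * (-(((c - m : ℝ) : ℂ) + τ * Complex.I)) by push_cast; ring,
      Complex.exp_add]
    ring
  simp_rw [hτ]
  rw [integral_const_mul, h]
  push_cast
  ring

/-! ### Geometric remainders and their Laplace transforms. -/

/-- The remainder of the geometric expansion of `2 / (t² + a²)`. -/
def geomRemainder (m : ℕ) (a t : ℝ) : ℝ := 2 * (-1) ^ m * (t / a) ^ (2 * m) / (t ^ 2 + a ^ 2)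

/-- Take u = ln(a/t) in `integral_exp_div_sin`. The power of t is written as (2s-1) - 1 so that the
Laplace transform is visibly a Gamma integral at 2s - 1. -/
lemma geomRemainder_eq_integral {m : ℕ} {c : ℝ} (h0 : (m : ℝ) < c) (h1 : c < m + 1) {a t : ℝ}
    (ha : 0 < a) (ht : 0 < t) :
    (geomRemainder m a t : ℂ) = ∫ τ : ℝ, (t : ℂ) ^ ((2 * ((c : ℂ) + τ * Complex.I) - 1) - 1) *
      (Complex.exp (-2 * ((c : ℂ) + τ * Complex.I) * Real.log a) *
        (Complex.sin (Real.pi * (c + τ * Complex.I)))⁻¹) := by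
  have ht' : (t : ℂ) ≠ 0 := by exact_mod_cast ht.ne'
  have h := integral_exp_div_sin h0 h1 (Real.log a - Real.log t)
  have hτ : ∀ τ : ℝ, (t : ℂ) ^ ((2 * ((c : ℂ) + τ * Complex.I) - 1) - 1) *
      (Complex.exp (-2 * ((c : ℂ) + τ * Complex.I) * Real.log a) *
        (Complex.sin (Real.pi * (c + τ * Complex.I)))⁻¹) =
      ((t : ℂ) ^ 2)⁻¹ * (Complex.exp (-2 * ((c : ℂ) + τ * Complex.I) *
        ((Real.log a - Real.log t : ℝ) : ℂ)) *
        (Complex.sin (Real.pi * (c + τ * Complex.I)))⁻¹) := by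
    intro τ
    rw [show (2 * ((c : ℂ) + τ * Complex.I) - 1) - 1 = 2 * ((c : ℂ) + τ * Complex.I) - (2 : ℕ) by
      push_cast; ring, Complex.cpow_sub _ _ ht', Complex.cpow_natCast,
      Complex.cpow_def_of_ne_zero ht', ← Complex.ofReal_log ht.le,
      show -2 * ((c : ℂ) + τ * Complex.I) * ((Real.log a - Real.log t : ℝ) : ℂ) =
        -2 * ((c : ℂ) + τ * Complex.I) * Real.log a +
          Real.log t * (2 * ((c : ℂ) + τ * Complex.I)) by push_cast; ring, Complex.exp_add]
    ring
  simp_rw [hτ]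
  rw [integral_const_mul, h]
  have e1 : Complex.exp (2 * ((Real.log a - Real.log t : ℝ) : ℂ)) = ((a / t) ^ 2 : ℝ) := by
    rw [← Real.log_div ha.ne' ht.ne', ← Real.exp_log (by positivity : 0 < (a / t) ^ 2),
      Real.log_pow]
    push_cast
    rfl
  have e2 : Complex.exp (-2 * m * ((Real.log a - Real.log t : ℝ) : ℂ)) =
      ((t / a) ^ (2 * m) : ℝ) := by
    rw [← neg_sub, ← Real.log_div ht.ne' ha.ne',
      ← Real.exp_log (by positivity : 0 < (t / a) ^ (2 * m)), Real.log_pow]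
    push_cast
    congr 1
    ring
  rw [e1, e2]
  have h3 : (t ^ 2 + a ^ 2 : ℂ) ≠ 0 := by norm_cast; positivity
  have h4 : (1 + ((a / t) ^ 2 : ℝ) : ℂ) ≠ 0 := by norm_cast; positivity
  rw [geomRemainder]
  push_cast at h4 ⊢
  have h5 : (1 + (a / t) ^ 2 : ℂ) = (t ^ 2 + a ^ 2) / t ^ 2 := by field_simp
  rw [h5]
  field_simp

/-- The modulus factors into a function of t times a function of τ; c > 1/2 makes t^{2c-2}
integrable at 0. -/
lemma integrable_prod_laplace_mellin {c : ℝ} (hc : 1 / 2 < c) (hs : Real.sin (Real.pi * c) ≠ 0)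
    {a x : ℝ} (hx : 0 < x) :
    Integrable (fun p : ℝ × ℝ => (p.1 : ℂ) ^ ((2 * ((c : ℂ) + p.2 * Complex.I) - 1) - 1) *
      Complex.exp (-(x * p.1)) *
      (Complex.exp (-2 * ((c : ℂ) + p.2 * Complex.I) * Real.log a) *
        (Complex.sin (Real.pi * (c + p.2 * Complex.I)))⁻¹))
      ((volume.restrict (Ioi 0)).prod volume) := by
  have h1 : IntegrableOn (fun t : ℝ => t ^ (2 * c - 2) * Real.exp (-x * t ^ (1 : ℝ))) (Ioi 0) :=
    integrableOn_rpow_mul_exp_neg_mul_rpow (by linarith) one_pos hx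
  have hdom := h1.mul_prod ((integrable_inv_sin_vertical hs).norm.const_mul
    (Real.exp (-2 * c * Real.log a)))
  refine hdom.mono (by fun_prop : Measurable _).aestronglyMeasurable ?_
  have hmem : ∀ᵐ p : ℝ × ℝ ∂((volume.restrict (Ioi 0)).prod volume), p.1 ∈ Ioi (0 : ℝ) :=
    Measure.quasiMeasurePreserving_fst.ae (ae_restrict_mem measurableSet_Ioi)
  refine hmem.mono ?_
  rintro ⟨t, τ⟩ ht
  have ht : 0 < t := ht
  have hn1 : ‖(t : ℂ) ^ ((2 * ((c : ℂ) + τ * Complex.I) - 1) - 1)‖ = t ^ (2 * c - 2) := by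
    rw [Complex.norm_cpow_eq_rpow_re_of_pos ht]
    congr 1; simp; ring
  have hn2 : ‖Complex.exp (-(x * t))‖ = Real.exp (-x * t ^ (1 : ℝ)) := by
    rw [Complex.norm_exp, Real.rpow_one]; congr 1; simp
  have hn3 : ‖Complex.exp (-2 * ((c : ℂ) + τ * Complex.I) * Real.log a)‖ =
      Real.exp (-2 * c * Real.log a) := by
    rw [norm_exp_vertical]; simp
  rw [norm_mul, norm_mul, norm_mul, hn1, hn2, hn3, norm_mul, norm_mul, norm_mul, norm_norm,
    Real.norm_of_nonneg (Real.rpow_nonneg ht.le _), Real.norm_of_nonneg (Real.exp_pos _).le,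
    Real.norm_of_nonneg (Real.exp_pos _).le]

/-- The Laplace transform of the remainder of the geometric expansion of `2 / (t² + a²)` as a
Mellin-Barnes integral. -/
lemma integral_exp_mul_geomRemainder {m : ℕ} {c : ℝ} (hc : 1 / 2 < c) (h0 : (m : ℝ) < c)
    (h1 : c < m + 1) {a x : ℝ} (ha : 0 < a) (hx : 0 < x) :
    ∫ t in Ioi (0 : ℝ), ((Real.exp (-x * t) * geomRemainder m a t : ℝ) : ℂ) =
      ∫ τ : ℝ, x * (Complex.exp (-2 * ((c : ℂ) + τ * Complex.I) *
        ((Real.log a + Real.log x : ℝ) : ℂ)) * gammaDivSin (c + τ * Complex.I)) := by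
  have hx' : (x : ℂ) ≠ 0 := by exact_mod_cast hx.ne'
  have hs : Real.sin (Real.pi * c) ≠ 0 :=
    sin_pi_mul_ne_zero_of_mem_Ioo (N := m + 1) (by push_cast; linarith) (by push_cast; linarith)
  have hinner : ∀ t ∈ Ioi (0 : ℝ), ((Real.exp (-x * t) * geomRemainder m a t : ℝ) : ℂ) =
      ∫ τ : ℝ, (t : ℂ) ^ ((2 * ((c : ℂ) + τ * Complex.I) - 1) - 1) * Complex.exp (-(x * t)) *
      (Complex.exp (-2 * ((c : ℂ) + τ * Complex.I) * Real.log a) *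
        (Complex.sin (Real.pi * (c + τ * Complex.I)))⁻¹) := by
    intro t ht
    rw [Complex.ofReal_mul, geomRemainder_eq_integral h0 h1 ha ht, ← integral_const_mul]
    refine integral_congr_ae (Eventually.of_forall fun τ => ?_)
    simp only
    push_cast
    rw [neg_mul]
    ring
  rw [setIntegral_congr_fun measurableSet_Ioi hinner,
    integral_integral_swap (integrable_prod_laplace_mellin hc hs hx)]
  refine integral_congr_ae (Eventually.of_forall fun τ => ?_)
  simp only
  rw [integral_mul_const, Complex.integral_cpow_mul_exp_neg_mul_Ioi (by simp; linarith) hx,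
    one_div, ← Complex.ofReal_inv, Complex.cpow_def_of_ne_zero (by
      exact_mod_cast (inv_pos.mpr hx).ne'), ← Complex.ofReal_log (inv_pos.mpr hx).le, Real.log_inv,
    gammaDivSin,
    show ((-Real.log x : ℝ) : ℂ) * (2 * ((c : ℂ) + τ * Complex.I) - 1) = Real.log x +
      -2 * ((c : ℂ) + τ * Complex.I) * Real.log x by push_cast; ring, Complex.exp_add,
    ← Complex.ofReal_exp, Real.exp_log hx,
    show -2 * ((c : ℂ) + τ * Complex.I) * ((Real.log a + Real.log x : ℝ) : ℂ) =
      -2 * ((c : ℂ) + τ * Complex.I) * Real.log a +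
      -2 * ((c : ℂ) + τ * Complex.I) * Real.log x by push_cast; ring, Complex.exp_add]
  ring

/-! ### Summation over n: the factor ζ(2s) and the truncated Stirling series. -/

/-- The Mellin-Barnes integral `∫ e^{-2sl} ζ(2s) Γ(2s-1) / sin(πs) dτ` over `s = c + iτ`. -/
def mbLine (c : ℝ) (l : ℂ) : ℂ :=
  ∫ τ : ℝ, Complex.exp (-2 * ((c : ℂ) + τ * Complex.I) * l) *
    (riemannZeta (2 * ((c : ℂ) + τ * Complex.I)) * gammaDivSin (c + τ * Complex.I))

lemma one_lt_re_two_mul_vertical {c : ℝ} (hc : 1 / 2 < c) (τ : ℝ) :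
    1 < (2 * ((c : ℂ) + τ * Complex.I)).re := by
  simp; linarith

lemma continuous_zeta_mul_gammaDivSin {c : ℝ} (hc : 1 / 2 < c)
    (hs : Real.sin (Real.pi * c) ≠ 0) :
    Continuous fun τ : ℝ =>
      riemannZeta (2 * ((c : ℂ) + τ * Complex.I)) * gammaDivSin (c + τ * Complex.I) := by
  refine Continuous.mul ?_ (continuous_gammaDivSin_vertical hc hs)
  rw [continuous_iff_continuousAt]
  intro τ
  refine ContinuousAt.comp (g := riemannZeta) (f := fun τ : ℝ => 2 * ((c : ℂ) + τ * Complex.I))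
    (differentiableAt_riemannZeta fun h => ?_).continuousAt (by fun_prop)
  have := one_lt_re_two_mul_vertical hc τ
  rw [h] at this
  simp at this

lemma summable_one_div_nat_add_one_rpow {p : ℝ} (hp : 1 < p) :
    Summable fun n : ℕ => 1 / ((n : ℝ) + 1) ^ p := by
  simpa using (summable_nat_add_iff 1).mpr (Real.summable_one_div_nat_rpow.mpr hp)

lemma norm_nat_add_one_cpow (n : ℕ) (s : ℂ) : ‖1 / ((n : ℂ) + 1) ^ s‖ = 1 / ((n : ℝ) + 1) ^ s.re := by
  rw [norm_div, norm_one, show (n : ℂ) + 1 = ((n + 1 : ℝ) : ℂ) by push_cast; rfl,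
    Complex.norm_cpow_eq_rpow_re_of_pos (by positivity)]

lemma hasSum_riemannZeta {s : ℂ} (hs : 1 < s.re) :
    HasSum (fun n : ℕ => 1 / ((n : ℂ) + 1) ^ s) (riemannZeta s) := by
  rw [zeta_eq_tsum_one_div_nat_add_one_cpow hs]
  refine Summable.hasSum (Summable.of_norm ?_)
  simp_rw [norm_nat_add_one_cpow]
  exact summable_one_div_nat_add_one_rpow hs

lemma norm_riemannZeta_le {s : ℂ} (hs : 1 < s.re) :
    ‖riemannZeta s‖ ≤ ∑' n : ℕ, 1 / ((n : ℝ) + 1) ^ s.re := by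
  have h := summable_one_div_nat_add_one_rpow hs
  rw [← (hasSum_riemannZeta hs).tsum_eq]
  refine (norm_tsum_le_tsum_norm ?_).trans_eq ?_
  · simp_rw [norm_nat_add_one_cpow]; exact h
  · simp_rw [norm_nat_add_one_cpow]

/-- As 2c > 1, the Dirichlet series bounds ζ(2s) uniformly on the line, and the decay rate is
unaffected. -/
lemma exists_norm_zeta_mul_gammaDivSin_bound {c : ℝ} (hc : 1 / 2 < c)
    (hs : Real.sin (Real.pi * c) ≠ 0) (β : ℝ) (hβ : β < 2 * Real.pi) :
    ∃ C : ℝ, 0 < C ∧ ∀ τ : ℝ,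
      ‖riemannZeta (2 * ((c : ℂ) + τ * Complex.I)) * gammaDivSin (c + τ * Complex.I)‖ ≤
        C * Real.exp (-β * |τ|) := by
  obtain ⟨C, hC, h⟩ := exists_norm_gammaDivSin_bound hc hs hβ
  set K := ∑' n : ℕ, 1 / ((n : ℝ) + 1) ^ (2 * c) with hK
  have hK0 : 0 ≤ K := tsum_nonneg fun n => by positivity
  refine ⟨(K + 1) * C, by positivity, fun τ => ?_⟩
  have h1 : ‖riemannZeta (2 * ((c : ℂ) + τ * Complex.I))‖ ≤ K + 1 := by
    refine (norm_riemannZeta_le (one_lt_re_two_mul_vertical hc τ)).trans ?_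
    have : (2 * ((c : ℂ) + τ * Complex.I)).re = 2 * c := by simp
    rw [this]
    linarith
  rw [norm_mul, mul_assoc]
  exact mul_le_mul h1 (h τ) (norm_nonneg _) (by positivity)

/-- Summing the Mellin-Barnes integrals of the individual terms over `a = 2π(n+1)`. -/
lemma hasSum_integral_gammaDivSin {c : ℝ} (hc : 1 / 2 < c) (hs : Real.sin (Real.pi * c) ≠ 0)
    (x : ℝ) :
    HasSum (fun n : ℕ => ∫ τ : ℝ, x * (Complex.exp (-2 * ((c : ℂ) + τ * Complex.I) *
      ((Real.log (2 * Real.pi * ((n : ℝ) + 1)) + Real.log x : ℝ) : ℂ)) *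
        gammaDivSin (c + τ * Complex.I)))
      (x * mbLine c ((Real.log (2 * Real.pi) + Real.log x : ℝ) : ℂ)) := by
  have hpi := Real.pi_pos
  set L : ℝ := Real.log (2 * Real.pi) + Real.log x with hL
  set G : ℝ → ℂ := fun τ => x * (Complex.exp (-2 * ((c : ℂ) + τ * Complex.I) * (L : ℂ)) *
    gammaDivSin (c + τ * Complex.I)) with hG
  have hGint : Integrable G :=
    (integrable_exp_mul_of_decay (continuous_gammaDivSin_vertical hc hs)
      (fun β hβ => exists_norm_gammaDivSin_bound hc hs hβ) c (l := (L : ℂ))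
      (by simpa using hpi)).const_mul _
  have hF : ∀ (n : ℕ) (τ : ℝ), x * (Complex.exp (-2 * ((c : ℂ) + τ * Complex.I) *
      ((Real.log (2 * Real.pi * ((n : ℝ) + 1)) + Real.log x : ℝ) : ℂ)) *
        gammaDivSin (c + τ * Complex.I)) =
      1 / ((n : ℂ) + 1) ^ (2 * ((c : ℂ) + τ * Complex.I)) * G τ := by
    intro n τ
    have hn : (0 : ℝ) < n + 1 := by positivity
    rw [Real.log_mul (by positivity) hn.ne', show (n : ℂ) + 1 = ((n + 1 : ℝ) : ℂ) by
      push_cast; rfl, one_div, ← Complex.cpow_neg, Complex.cpow_def_of_ne_zero (by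
      exact_mod_cast hn.ne'), ← Complex.ofReal_log hn.le, hG, hL]
    simp only
    rw [show -2 * ((c : ℂ) + τ * Complex.I) *
      ((Real.log (2 * Real.pi) + Real.log ((n : ℝ) + 1) + Real.log x : ℝ) : ℂ) =
      (Real.log ((n : ℝ) + 1) : ℂ) * -(2 * ((c : ℂ) + τ * Complex.I)) +
      -2 * ((c : ℂ) + τ * Complex.I) * ((Real.log (2 * Real.pi) + Real.log x : ℝ) : ℂ) by
        push_cast; ring, Complex.exp_add]
    ring
  have hFnorm : ∀ (n : ℕ) (τ : ℝ),
      ‖1 / ((n : ℂ) + 1) ^ (2 * ((c : ℂ) + τ * Complex.I)) * G τ‖ =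
      1 / ((n : ℝ) + 1) ^ (2 * c) * ‖G τ‖ := by
    intro n τ
    rw [norm_mul, norm_nat_add_one_cpow]
    simp
  simp_rw [hF]
  -- The nth integrand has modulus (n+1)^{-2c} ‖G‖, so the interchange is absolute.
  have h := hasSum_integral_of_summable_integral_norm (μ := volume)
    (F := fun (n : ℕ) (τ : ℝ) => 1 / ((n : ℂ) + 1) ^ (2 * ((c : ℂ) + τ * Complex.I)) * G τ)
    (fun n => by
      refine (hGint.norm.const_mul (1 / ((n : ℝ) + 1) ^ (2 * c))).mono' ?_
        (Eventually.of_forall fun τ => (hFnorm n τ).le)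
      refine AEStronglyMeasurable.mul ?_ hGint.aestronglyMeasurable
      exact (by fun_prop : Measurable _).aestronglyMeasurable)
    (by
      simp_rw [hFnorm, integral_const_mul]
      exact (summable_one_div_nat_add_one_rpow (by linarith)).mul_right _)
  suffices e : x * mbLine c (L : ℂ) = ∫ τ : ℝ, ∑' n : ℕ,
      1 / ((n : ℂ) + 1) ^ (2 * ((c : ℂ) + τ * Complex.I)) * G τ by rw [e]; exact h
  rw [mbLine, ← integral_const_mul]
  refine integral_congr_ae (Eventually.of_forall fun τ => ?_)
  simp only
  rw [tsum_mul_right, (hasSum_riemannZeta (one_lt_re_two_mul_vertical hc τ)).tsum_eq, hG]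
  ring

lemma geomRemainder_succ {a : ℝ} (ha : 0 < a) (m : ℕ) (t : ℝ) :
    geomRemainder (m + 1) a t =
      geomRemainder m a t - 2 * (-1) ^ m / a ^ (2 * m + 2) * t ^ (2 * m) := by
  have : t ^ 2 + a ^ 2 ≠ 0 := by positivity
  rw [geomRemainder, geomRemainder, div_pow, div_pow]
  field_simp
  ring

lemma integrableOn_exp_mul_pow {x : ℝ} (hx : 0 < x) (k : ℕ) :
    IntegrableOn (fun t : ℝ => Real.exp (-x * t) * t ^ k) (Ioi 0) := by
  have h := integrableOn_rpow_mul_exp_neg_mul_rpow (s := k) (p := 1) (b := x)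
    (by have : (0 : ℝ) ≤ k := k.cast_nonneg
        linarith) one_pos hx
  refine h.congr_fun (fun t _ => ?_) measurableSet_Ioi
  simp only [Real.rpow_natCast, Real.rpow_one]
  ring

lemma integral_exp_mul_pow {x : ℝ} (hx : 0 < x) (k : ℕ) :
    ∫ t in Ioi (0 : ℝ), Real.exp (-x * t) * t ^ k = k.factorial / x ^ (k + 1) := by
  have h := Real.integral_rpow_mul_exp_neg_mul_Ioi (a := k + 1) (r := x) (by positivity) hx
  rw [Real.Gamma_nat_eq_factorial] at h
  have h2 : ((k : ℝ) + 1) = ((k + 1 : ℕ) : ℝ) := by push_cast; rfl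
  rw [h2, Real.rpow_natCast] at h
  rw [show (k.factorial / x ^ (k + 1) : ℝ) = (1 / x) ^ (k + 1) * k.factorial by
    rw [one_div, inv_pow]; ring, ← h]
  refine setIntegral_congr_fun measurableSet_Ioi fun t _ => ?_
  simp only [Nat.cast_add, Nat.cast_one, add_sub_cancel_right, Real.rpow_natCast, neg_mul]
  ring

lemma integrableOn_exp_mul_geomRemainder {a x : ℝ} (ha : 0 < a) (hx : 0 < x) (m : ℕ) :
    IntegrableOn (fun t : ℝ => Real.exp (-x * t) * geomRemainder m a t) (Ioi 0) := by
  induction m with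
  | zero =>
    refine (integrableOn_exp_neg_mul hx).mul_bdd (c := 2 / a ^ 2)
      (g := fun t => geomRemainder 0 a t) ?_ ?_
    · have : Continuous fun t => geomRemainder 0 a t := by
        unfold geomRemainder
        exact (by fun_prop : Continuous _).div (by fun_prop) fun t => by positivity
      exact this.aestronglyMeasurable
    · filter_upwards with t
      simp only [geomRemainder, pow_zero, mul_zero, mul_one]
      rw [Real.norm_of_nonneg (by positivity)]
      gcongr
      nlinarith [sq_nonneg t]
  | succ m ih =>
    refine (ih.sub ((integrableOn_exp_mul_pow hx (2 * m)).const_mul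
      (2 * (-1) ^ m / a ^ (2 * m + 2)))).congr_fun (fun t _ => ?_) measurableSet_Ioi
    simp only [Pi.sub_apply]
    rw [geomRemainder_succ ha]
    ring

lemma integral_exp_mul_geomRemainder_succ {a x : ℝ} (ha : 0 < a) (hx : 0 < x) (m : ℕ) :
    ∫ t in Ioi (0 : ℝ), Real.exp (-x * t) * geomRemainder (m + 1) a t =
      (∫ t in Ioi (0 : ℝ), Real.exp (-x * t) * geomRemainder m a t) -
        2 * (-1) ^ m / a ^ (2 * m + 2) * ((2 * m).factorial / x ^ (2 * m + 1)) := by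
  rw [← integral_exp_mul_pow hx, ← integral_const_mul, ← integral_sub
    (integrableOn_exp_mul_geomRemainder ha hx m) ((integrableOn_exp_mul_pow hx _).const_mul _)]
  refine setIntegral_congr_fun measurableSet_Ioi fun t _ => ?_
  rw [geomRemainder_succ ha]
  ring

lemma hasSum_integral_binet {x : ℝ} (hx : 0 < x) :
    HasSum (fun n : ℕ => ∫ t in Ioi (0 : ℝ),
      Real.exp (-x * t) * geomRemainder 0 (2 * Real.pi * ((n : ℝ) + 1)) t) (binetIntegral x) := by
  have hpi := Real.pi_pos
  have h := hasSum_integral_of_summable_integral_norm (μ := volume.restrict (Ioi (0 : ℝ)))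
    (F := fun (n : ℕ) (t : ℝ) => Real.exp (-x * t) *
      geomRemainder 0 (2 * Real.pi * ((n : ℝ) + 1)) t)
    (fun n => integrableOn_exp_mul_geomRemainder (by positivity) hx 0) (by
      refine Summable.of_nonneg_of_le (fun n => integral_nonneg fun t => norm_nonneg _) (fun n => ?_)
        (summable_binetBound.mul_right (1 / x))
      rw [← integral_exp_neg_mul hx, ← integral_const_mul]
      refine setIntegral_mono
        (integrableOn_exp_mul_geomRemainder (by positivity) hx 0).norm
        ((integrableOn_exp_neg_mul hx).const_mul _) fun t => ?_
      simp only [geomRemainder, pow_zero, mul_zero, mul_one]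
      rw [norm_mul, Real.norm_of_nonneg (Real.exp_pos _).le,
        Real.norm_of_nonneg (binetTerm_nonneg t n), mul_comm]
      exact mul_le_mul_of_nonneg_right (binetTerm_le t n) (Real.exp_pos _).le)
  suffices e : binetIntegral x = ∫ t in Ioi (0 : ℝ), ∑' n : ℕ, Real.exp (-x * t) *
      geomRemainder 0 (2 * Real.pi * ((n : ℝ) + 1)) t by rw [e]; exact h
  rw [binetIntegral]
  refine setIntegral_congr_fun measurableSet_Ioi fun t _ => ?_
  simp only [geomRemainder, pow_zero, mul_zero, mul_one]
  rw [tsum_mul_left, binetKernel]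

lemma truncatedSeries_one (z : ℂ) : truncatedSeries 1 z = 0 := by simp [truncatedSeries]

/-- The new index is k = m + 1. In this form its term is visibly the sum over a = 2π(n+1) of the
Laplace transforms of 2(-1)^m t^{2m}/a^{2m+2}. -/
lemma truncatedSeries_succ {z : ℂ} (hz : z ≠ 0) (m : ℕ) :
    truncatedSeries (m + 2) z = truncatedSeries (m + 1) z +
      2 * (-1) ^ m * ((2 * m).factorial / z ^ (2 * m + 1)) *
        (riemannZeta (2 * m + 2) / (2 * Real.pi) ^ (2 * m + 2)) := by
  have hπ : (Real.pi : ℂ) ≠ 0 := by exact_mod_cast Real.pi_ne_zero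
  rw [truncatedSeries, truncatedSeries, Finset.sum_Ico_succ_top (by omega), mul_add,
    cosecantPoly_one (by omega)]
  congr 1
  have hG : Complex.Gamma (2 * ((m + 1 : ℕ) : ℂ) - 1) = (2 * m).factorial := by
    rw [← Complex.Gamma_nat_eq_factorial]
    congr 1
    push_cast
    ring
  have hζ : 2 * (((m + 1 : ℕ)) : ℂ) = 2 * m + 2 := by push_cast; ring
  rw [hG, hζ]
  have e : 2 * (m + 1) = 2 * m + 2 := by ring
  rw [e, mul_pow, mul_pow]
  field_simp
  ring

/-- By induction from Binet's integral: each step peels one geometric term off every remainder, and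
summing these over n gives ζ(2m+2). -/
lemma hasSum_integral_geomRemainder {x : ℝ} (hx : 0 < x) (m : ℕ) :
    HasSum (fun n : ℕ => ((∫ t in Ioi (0 : ℝ),
      Real.exp (-x * t) * geomRemainder m (2 * Real.pi * ((n : ℝ) + 1)) t : ℝ) : ℂ))
      (binetIntegral x - truncatedSeries (m + 1) x) := by
  have hpi := Real.pi_pos
  have hx' : (x : ℂ) ≠ 0 := by exact_mod_cast hx.ne'
  induction m with
  | zero =>
    rw [truncatedSeries_one, sub_zero]
    exact Complex.hasSum_ofReal.mpr (hasSum_integral_binet hx)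
  | succ m ih =>
    have hz := hasSum_riemannZeta (s := ((2 * m + 2 : ℕ) : ℂ)) (by
      rw [Complex.natCast_re]; norm_cast; omega)
    have h := ih.sub (hz.mul_left (2 * (-1) ^ m * ((2 * m).factorial / (x : ℂ) ^ (2 * m + 1)) /
      (2 * Real.pi) ^ (2 * m + 2)))
    have hval : (binetIntegral x : ℂ) - truncatedSeries (m + 1 + 1) x =
        binetIntegral x - truncatedSeries (m + 1) x -
        2 * (-1) ^ m * ((2 * m).factorial / (x : ℂ) ^ (2 * m + 1)) /
      (2 * Real.pi) ^ (2 * m + 2) * riemannZeta ((2 * m + 2 : ℕ) : ℂ) := by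
      rw [truncatedSeries_succ hx']
      push_cast
      ring
    rw [hval]
    refine (congrArg (fun f : ℕ → ℂ => HasSum f _) (funext fun n => ?_)).mpr h
    rw [integral_exp_mul_geomRemainder_succ (by positivity) hx, Complex.cpow_natCast]
    push_cast
    rw [mul_pow (2 * Real.pi : ℂ)]
    field_simp

/-- The Mellin-Barnes representation of the remainder of Stirling's formula on the positive real
axis. -/
theorem binetIntegral_eq_add_mbLine {N : ℕ} (hN : 1 ≤ N) {c : ℝ} (hc : 1 / 2 < c)
    (h0 : (N : ℝ) - 1 < c) (h1 : c < N) {x : ℝ} (hx : 0 < x) :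
    (binetIntegral x : ℂ) = truncatedSeries N x +
      x * mbLine c ((Real.log (2 * Real.pi) + Real.log x : ℝ) : ℂ) := by
  have hpi := Real.pi_pos
  obtain ⟨m, rfl⟩ : ∃ m, N = m + 1 := ⟨N - 1, by omega⟩
  have hs := sin_pi_mul_ne_zero_of_mem_Ioo h0 h1
  push_cast at h0 h1
  have h2 := hasSum_integral_gammaDivSin hc hs x
  have h3 : ∀ n : ℕ, ∫ τ : ℝ, x * (Complex.exp (-2 * ((c : ℂ) + τ * Complex.I) *
      ((Real.log (2 * Real.pi * ((n : ℝ) + 1)) + Real.log x : ℝ) : ℂ)) *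
        gammaDivSin (c + τ * Complex.I)) = ((∫ t in Ioi (0 : ℝ),
      Real.exp (-x * t) * geomRemainder m (2 * Real.pi * ((n : ℝ) + 1)) t : ℝ) : ℂ) := by
    intro n
    rw [← integral_exp_mul_geomRemainder hc (by linarith) h1 (by positivity) hx,
      integral_complex_ofReal]
  simp_rw [h3] at h2
  rw [h2.unique (hasSum_integral_geomRemainder hx m)]
  ring

/-! ### Continuation to the slit plane and the principal branch. -/

/-- Stirling's formula with Mellin-Barnes remainder, as a function on the slit plane. -/
def stirlingLog (N : ℕ) (c : ℝ) (z : ℂ) : ℂ :=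
  (z - 1 / 2) * Complex.log z - z + (1 / 2) * (Real.log (2 * Real.pi) : ℂ) +
    truncatedSeries N z + z * mbLine c ((Real.log (2 * Real.pi) : ℂ) + Complex.log z)

lemma differentiableAt_truncatedSeries (N : ℕ) {z : ℂ} (hz : z ≠ 0) :
    DifferentiableAt ℂ (truncatedSeries N) z := by
  unfold truncatedSeries
  refine differentiableAt_id.mul (DifferentiableAt.fun_sum fun k _ => ?_)
  refine (DifferentiableAt.mul_const ?_ _).mul_const _
  exact (differentiableAt_const _).div (by fun_prop) (pow_ne_zero _ (mul_ne_zero two_ne_zero hz))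

lemma abs_arg_lt_pi_of_mem_slitPlane {z : ℂ} (hz : z ∈ Complex.slitPlane) :
    |z.arg| < Real.pi := by
  rw [abs_lt]
  exact ⟨Complex.neg_pi_lt_arg z, lt_of_le_of_ne (Complex.arg_le_pi z)
    (Complex.mem_slitPlane_iff_arg.mp hz).1⟩

lemma differentiableAt_stirlingLog (N : ℕ) {c : ℝ} (hc : 1 / 2 < c)
    (hs : Real.sin (Real.pi * c) ≠ 0) {z : ℂ} (hz : z ∈ Complex.slitPlane) :
    DifferentiableAt ℂ (stirlingLog N c) z := by
  have hlog : DifferentiableAt ℂ Complex.log z := Complex.differentiableAt_log hz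
  have hmb : DifferentiableAt ℂ
      (fun z => mbLine c ((Real.log (2 * Real.pi) : ℂ) + Complex.log z)) z := by
    refine DifferentiableAt.comp z (g := mbLine c)
      (differentiableAt_integral_exp_mul (continuous_zeta_mul_gammaDivSin hc hs)
        (exists_norm_zeta_mul_gammaDivSin_bound hc hs) c ?_)
      (hlog.const_add _)
    rw [Complex.add_im, Complex.ofReal_im, zero_add, Complex.log_im]
    exact abs_arg_lt_pi_of_mem_slitPlane hz
  have htr := differentiableAt_truncatedSeries N (Complex.slitPlane_ne_zero hz)
  unfold stirlingLog
  fun_prop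

lemma stirlingLog_ofReal {N : ℕ} (hN : 1 ≤ N) {c : ℝ} (hc : 1 / 2 < c)
    (h0 : (N : ℝ) - 1 < c) (h1 : c < N) {x : ℝ} (hx : 0 < x) :
    stirlingLog N c x = (Real.log (Real.Gamma x) : ℂ) := by
  have h := binetIntegral_eq_add_mbLine hN hc h0 h1 hx
  rw [log_Gamma_eq_add_binetIntegral hx, stirlingLog, Complex.ofReal_add, h, realLeadingTerms,
    ← Complex.ofReal_log hx.le]
  push_cast
  ring

lemma isPreconnected_slitPlane : IsPreconnected Complex.slitPlane :=
  Complex.starConvex_one_slitPlane.isPathConnected Complex.one_mem_slitPlane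
    |>.isConnected.isPreconnected

lemma differentiableAt_Gamma_of_mem_slitPlane {z : ℂ} (hz : z ∈ Complex.slitPlane) :
    DifferentiableAt ℂ Complex.Gamma z := by
  refine Complex.differentiableAt_Gamma z fun m h => ?_
  rw [h, ← Complex.ofReal_natCast, ← Complex.ofReal_neg, Complex.ofReal_mem_slitPlane] at hz
  have : (0 : ℝ) ≤ m := m.cast_nonneg
  linarith

/-- Identity theorem: both sides are analytic on the connected slit plane, which contains no pole of
Γ, and agree at the points 1 + 1/(n+1), which accumulate at 1. -/
lemma exp_stirlingLog {N : ℕ} (hN : 1 ≤ N) {c : ℝ} (hc : 1 / 2 < c)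
    (h0 : (N : ℝ) - 1 < c) (h1 : c < N) {z : ℂ} (hz : z ∈ Complex.slitPlane) :
    Complex.exp (stirlingLog N c z) = Complex.Gamma z := by
  have hs := sin_pi_mul_ne_zero_of_mem_Ioo h0 h1
  have hf : AnalyticOnNhd ℂ (fun z => Complex.exp (stirlingLog N c z)) Complex.slitPlane :=
    DifferentiableOn.analyticOnNhd (fun w hw =>
      (differentiableAt_stirlingLog N hc hs hw).cexp.differentiableWithinAt)
      Complex.isOpen_slitPlane
  have hg : AnalyticOnNhd ℂ Complex.Gamma Complex.slitPlane :=
    DifferentiableOn.analyticOnNhd (fun w hw =>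
      (differentiableAt_Gamma_of_mem_slitPlane hw).differentiableWithinAt)
      Complex.isOpen_slitPlane
  refine hf.eqOn_of_preconnected_of_frequently_eq hg isPreconnected_slitPlane
    Complex.one_mem_slitPlane ?_ hz
  have hlim : Tendsto (fun n : ℕ => ((1 + 1 / ((n : ℝ) + 1) : ℝ) : ℂ)) atTop (𝓝[≠] 1) := by
    rw [tendsto_nhdsWithin_iff]
    constructor
    · have h := (tendsto_one_div_add_atTop_nhds_zero_nat (𝕜 := ℝ)).const_add 1
      rw [add_zero] at h
      have h2 := (Complex.continuous_ofReal.tendsto 1).comp h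
      rwa [Complex.ofReal_one] at h2
    · refine Eventually.of_forall fun n h => ?_
      have h : (((1 + 1 / ((n : ℝ) + 1) : ℝ)) : ℂ) = 1 := h
      have h : (1 + 1 / ((n : ℝ) + 1) : ℝ) = 1 := by exact_mod_cast h
      have : 0 < 1 / ((n : ℝ) + 1) := by positivity
      linarith
  refine hlim.frequently (Frequently.of_forall fun n => ?_)
  have hx : (0 : ℝ) < 1 + 1 / ((n : ℝ) + 1) := by positivity
  rw [stirlingLog_ofReal hN hc h0 h1 hx, ← Complex.ofReal_exp,
    Real.exp_log (Real.Gamma_pos_of_pos hx), Complex.Gamma_ofReal]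

lemma one_add_mul_sub_one_mem_slitPlane {z : ℂ} (hz : z ∈ Complex.slitPlane) {t : ℝ}
    (ht : t ∈ Icc (0 : ℝ) 1) : 1 + (t : ℂ) * (z - 1) ∈ Complex.slitPlane := by
  simpa using Complex.starConvex_one_slitPlane.add_smul_sub_mem hz ht.1 ht.2

/-- Stirling's formula for the principal branch of `ln Γ`. -/
theorem logGamma_eq_stirlingLog {N : ℕ} (hN : 1 ≤ N) {c : ℝ} (hc : 1 / 2 < c)
    (h0 : (N : ℝ) - 1 < c) (h1 : c < N) {z : ℂ} (hz : z ∈ Complex.slitPlane) :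
    logGamma z = stirlingLog N c z := by
  have hs := sin_pi_mul_ne_zero_of_mem_Ioo h0 h1
  have hdiff : DifferentiableOn ℂ (stirlingLog N c) Complex.slitPlane := fun w hw =>
    (differentiableAt_stirlingLog N hc hs hw).differentiableWithinAt
  -- Since e^{`stirlingLog`} = Γ, the logarithmic derivative of Γ is the derivative of
  -- `stirlingLog`, so the defining integral of `logGamma` telescopes.
  have hderiv : ∀ w ∈ Complex.slitPlane, Complex.digamma w = deriv (stirlingLog N c) w := by
    intro w hw
    have hev : Complex.Gamma =ᶠ[𝓝 w] fun z => Complex.exp (stirlingLog N c z) := by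
      filter_upwards [Complex.isOpen_slitPlane.mem_nhds hw] with y hy
      exact (exp_stirlingLog hN hc h0 h1 hy).symm
    rw [Complex.digamma_def, logDeriv_apply, hev.deriv_eq,
      ((differentiableAt_stirlingLog N hc hs hw).hasDerivAt.cexp).deriv,
      exp_stirlingLog hN hc h0 h1 hw, mul_div_assoc, mul_comm, div_mul_cancel₀]
    rw [← exp_stirlingLog hN hc h0 h1 hw]
    exact Complex.exp_ne_zero _
  have hcont : ContinuousOn (deriv (stirlingLog N c)) Complex.slitPlane :=
    (hdiff.deriv Complex.isOpen_slitPlane).continuousOn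
  have hmem : ∀ t ∈ uIcc (0 : ℝ) 1, 1 + (t : ℂ) * (z - 1) ∈ Complex.slitPlane := by
    intro t ht
    rw [uIcc_of_le zero_le_one] at ht
    exact one_add_mul_sub_one_mem_slitPlane hz ht
  rw [logGamma, intervalIntegral.integral_eq_sub_of_hasDerivAt
    (f := fun t : ℝ => stirlingLog N c (1 + (t : ℂ) * (z - 1)))]
  · have hone : stirlingLog N c 1 = 0 := by
      have := stirlingLog_ofReal hN hc h0 h1 one_pos
      simpa using this
    simp [hone]
  · intro t ht
    rw [hderiv _ (hmem t ht), mul_comm]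
    have hin : HasDerivAt (fun t : ℝ => 1 + (t : ℂ) * (z - 1)) (z - 1) t := by
      have := ((Complex.ofRealCLM.hasDerivAt (x := t)).mul_const (z - 1)).const_add 1
      simpa using this
    exact (differentiableAt_stirlingLog N hc hs (hmem t ht)).hasDerivAt.comp t hin
  · refine ContinuousOn.intervalIntegrable ?_
    refine continuousOn_const.mul ?_
    refine ContinuousOn.congr (f := fun t : ℝ => deriv (stirlingLog N c) (1 + (t : ℂ) * (z - 1)))
      ?_ fun t ht => hderiv _ (hmem t ht)
    exact hcont.comp (by fun_prop : Continuous _).continuousOn hmem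

lemma exp_logGamma {z : ℂ} (hz : z ∈ Complex.slitPlane) :
    Complex.exp (logGamma z) = Complex.Gamma z := by
  -- Any admissible N and c would serve, as neither occurs in the statement.
  rw [logGamma_eq_stirlingLog (N := 1) le_rfl (c := 3 / 4) (by norm_num) (by norm_num)
    (by norm_num) hz]
  exact exp_stirlingLog le_rfl (by norm_num) (by norm_num) (by norm_num) hz

lemma continuousAt_logGamma {z : ℂ} (hz : z ∈ Complex.slitPlane) : ContinuousAt logGamma z := by
  have h : logGamma =ᶠ[𝓝 z] stirlingLog 1 (3 / 4) := by
    filter_upwards [Complex.isOpen_slitPlane.mem_nhds hz] with w hw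
    exact logGamma_eq_stirlingLog le_rfl (by norm_num) (by norm_num) (by norm_num) hw
  refine ContinuousAt.congr (DifferentiableAt.continuousAt (𝕜 := ℂ) ?_) h.symm
  exact differentiableAt_stirlingLog 1 (by norm_num)
    (sin_pi_mul_ne_zero_of_mem_Ioo (N := 1) (by norm_num) (by norm_num)) hz

lemma digamma_conj (z : ℂ) :
    Complex.digamma ((starRingEnd ℂ) z) = (starRingEnd ℂ) (Complex.digamma z) := by
  have hG : (starRingEnd ℂ) ∘ Complex.Gamma ∘ (starRingEnd ℂ) = Complex.Gamma := by
    funext w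
    simp [Complex.Gamma_conj]
  rw [Complex.digamma_def, logDeriv_apply, logDeriv_apply, map_div₀, Complex.Gamma_conj]
  congr 1
  have h := congrFun (deriv_conj_conj (f := Complex.Gamma)) ((starRingEnd ℂ) z)
  rw [hG] at h
  simpa using h

/-- Needed on the imaginary axis, where -z = conj z. -/
lemma logGamma_conj (z : ℂ) :
    logGamma ((starRingEnd ℂ) z) = (starRingEnd ℂ) (logGamma z) := by
  rw [logGamma, logGamma, intervalIntegral.integral_of_le zero_le_one,
    intervalIntegral.integral_of_le zero_le_one, ← integral_conj]
  refine integral_congr_ae (Eventually.of_forall fun t => ?_)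
  simp [← digamma_conj]

/-! ### The Riemann surface and the rotation by ∓Mπ. -/

lemma point_eq_exp {r : ℝ} (hr : 0 < r) (φ : ℝ) : point r φ = Complex.exp (surfaceLog r φ) := by
  rw [surfaceLog, Complex.exp_add, ← Complex.ofReal_exp, Real.exp_log hr, point]

lemma point_ne_zero {r : ℝ} (hr : 0 < r) (φ : ℝ) : point r φ ≠ 0 := by
  rw [point_eq_exp hr]; exact Complex.exp_ne_zero _

lemma continuous_point (r : ℝ) : Continuous (point r) := by
  unfold point; fun_prop

lemma continuous_surfaceLog (r : ℝ) : Continuous (surfaceLog r) := by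
  unfold surfaceLog; fun_prop

lemma continuous_leadingTerms (r : ℝ) : Continuous (leadingTerms r) := by
  have h1 := continuous_point r
  have h2 := continuous_surfaceLog r
  unfold leadingTerms; fun_prop

lemma surfaceLog_im (r φ : ℝ) : (surfaceLog r φ).im = φ := by simp [surfaceLog]

lemma log_point {r φ : ℝ} (hr : 0 < r) (hφ : |φ| < Real.pi) :
    Complex.log (point r φ) = surfaceLog r φ := by
  rw [abs_lt] at hφ
  rw [point_eq_exp hr, Complex.log_exp]
  · rw [surfaceLog_im]; exact hφ.1
  · rw [surfaceLog_im]; exact hφ.2.le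

lemma point_mem_slitPlane {r φ : ℝ} (hr : 0 < r) (hφ : |φ| < Real.pi) :
    point r φ ∈ Complex.slitPlane := by
  rw [Complex.mem_slitPlane_iff_arg]
  refine ⟨?_, point_ne_zero hr φ⟩
  rw [← Complex.log_im, log_point hr hφ, surfaceLog_im]
  exact (abs_lt.mp hφ).2.ne

lemma exp_sign_mul_pi {ε : ℝ} (hε : ε = 1 ∨ ε = -1) (k : ℕ) :
    Complex.exp (Complex.I * ε * Real.pi * k) = (-1) ^ k := by
  rw [mul_comm _ (k : ℂ), Complex.exp_nat_mul]
  congr 1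
  rcases hε with rfl | rfl
  · rw [Complex.ofReal_one, mul_one, mul_comm, Complex.exp_pi_mul_I]
  · rw [show Complex.I * ((-1 : ℝ) : ℂ) * Real.pi = -(Real.pi * Complex.I) by push_cast; ring,
      Complex.exp_neg, Complex.exp_pi_mul_I]
    norm_num

lemma exp_sign_mul_pi_div_two {ε : ℝ} (hε : ε = 1 ∨ ε = -1) :
    Complex.exp (Complex.I * ε * (Real.pi / 2)) = ε * Complex.I := by
  rcases hε with rfl | rfl
  · rw [Complex.ofReal_one, mul_one, one_mul, mul_comm, Complex.exp_pi_div_two_mul_I]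
  · rw [show Complex.I * ((-1 : ℝ) : ℂ) * (Real.pi / 2) = -(Real.pi / 2 * Complex.I) by
      push_cast; ring, Complex.exp_neg, Complex.exp_pi_div_two_mul_I]
    simp

lemma sign_sq {ε : ℝ} (hε : ε = 1 ∨ ε = -1) : (ε : ℂ) ^ 2 = 1 := by
  rcases hε with rfl | rfl <;> norm_num

lemma point_sub {ε : ℝ} (hε : ε = 1 ∨ ε = -1) (M : ℕ) (r φ : ℝ) :
    point r (φ - ε * M * Real.pi) = (-1) ^ M * point r φ := by
  rw [point, point, show ((φ - ε * M * Real.pi : ℝ) : ℂ) * Complex.I =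
    φ * Complex.I - Complex.I * ε * Real.pi * M by push_cast; ring, Complex.exp_sub,
    exp_sign_mul_pi hε, div_eq_mul_inv, ← inv_pow, inv_neg_one]
  ring

/-- The factor e^{2εMiπs} merges with e^{-2s ln z} and lowers the argument by εMπ; the denominator
is -2i sin(πs), whence i/2. -/
lemma mbIntegrand_eq (ε : ℝ) (M : ℕ) (r θ : ℝ) (s : ℂ) :
    mbIntegrand ε M r θ s = Complex.I / 2 *
      (Complex.exp (-2 * s * ((Real.log (2 * Real.pi) : ℂ) +
        surfaceLog r (θ - ε * M * Real.pi))) * (riemannZeta (2 * s) * gammaDivSin s)) := by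
  have hden : Complex.exp (-Complex.I * Real.pi * s) - Complex.exp (Complex.I * Real.pi * s) =
      -2 * Complex.I * Complex.sin (Real.pi * s) := by
    rw [Complex.sin, show -(Real.pi * s) * Complex.I = -Complex.I * Real.pi * s by ring,
      show Real.pi * s * Complex.I = Complex.I * Real.pi * s by ring]
    linear_combination (Complex.exp (-Complex.I * Real.pi * s) -
      Complex.exp (Complex.I * Real.pi * s)) * Complex.I_sq
  have hexp : Complex.exp (-2 * s * ((Real.log (2 * Real.pi) : ℂ) +
      surfaceLog r (θ - ε * M * Real.pi))) =
      Complex.exp (-2 * s * ((Real.log (2 * Real.pi) : ℂ) + surfaceLog r θ)) *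
        Complex.exp ((ε : ℂ) * 2 * (M : ℂ) * Complex.I * (Real.pi : ℂ) * s) := by
    rw [← Complex.exp_add]
    congr 1
    rw [surfaceLog, surfaceLog]
    push_cast
    ring
  rw [mbIntegrand, hden, hexp, gammaDivSin]
  have hI : (-2 * Complex.I * Complex.sin (Real.pi * s))⁻¹ =
      Complex.I / 2 * (Complex.sin (Real.pi * s))⁻¹ := by
    rw [mul_inv, mul_inv, Complex.inv_I]; ring
  rw [div_eq_mul_inv _ (-2 * Complex.I * Complex.sin (Real.pi * s)), hI]
  ring

lemma mbIntegral_eq (ε : ℝ) (M : ℕ) (c r θ : ℝ) :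
    mbIntegral ε M c r θ = -(1 / 2) * mbLine c ((Real.log (2 * Real.pi) : ℂ) +
        surfaceLog r (θ - ε * M * Real.pi)) := by
  simp only [mbIntegral, mbIntegrand_eq]
  rw [integral_const_mul, mbLine, ← mul_assoc]
  congr 1
  linear_combination (1 / 2 : ℂ) * Complex.I_sq

lemma integrable_mbIntegrand {c : ℝ} (hc : 1 / 2 < c) (hs : Real.sin (Real.pi * c) ≠ 0)
    (ε : ℝ) (M : ℕ) (r θ : ℝ) (hθ : |θ - ε * M * Real.pi| < Real.pi) :
    Integrable (fun t : ℝ => mbIntegrand ε M r θ ((c : ℂ) + (t : ℂ) * Complex.I)) := by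
  simp only [mbIntegrand_eq]
  refine (integrable_exp_mul_of_decay (continuous_zeta_mul_gammaDivSin hc hs)
    (exists_norm_zeta_mul_gammaDivSin_bound hc hs) c ?_).const_mul _
  rwa [Complex.add_im, Complex.ofReal_im, zero_add, surfaceLog_im]

lemma truncatedSeries_neg_one_pow_mul (N M : ℕ) (z : ℂ) :
    truncatedSeries N ((-1) ^ M * z) = (-1) ^ M * truncatedSeries N z := by
  rw [truncatedSeries, truncatedSeries, mul_assoc]
  congr 2
  refine Finset.sum_congr rfl fun k _ => ?_
  have : (2 * ((-1) ^ M * z)) ^ (2 * k) = (2 * z) ^ (2 * k) := by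
    rw [show 2 * ((-1) ^ M * z) = (-1) ^ M * (2 * z) by ring, mul_pow, ← pow_mul, mul_left_comm,
      pow_mul, neg_one_sq, one_pow, one_mul]
  rw [this]

/-- The right-hand side of the formula for `ln Γ(z)` without `S_MB`, in terms of the principal
branch of `ln Γ` at `(-1)^M z`. -/
def mbCore (ε : ℝ) (M : ℕ) (r φ : ℝ) : ℂ :=
  leadingTerms r φ + (-1) ^ M *
    (logGamma (point r (φ - ε * M * Real.pi)) - leadingTerms r (φ - ε * M * Real.pi))

/-- Stirling's formula at (-1)^M z is solved for series plus integral, and TS_N is odd, so both pick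
up the sign (-1)^M. What remains no longer depends on N and c. -/
lemma mbFormula_eq {N : ℕ} (hN : 1 ≤ N) {c : ℝ} (hc : 1 / 2 < c)
    (h0 : (N : ℝ) - 1 < c) (h1 : c < N) {ε : ℝ} (hε : ε = 1 ∨ ε = -1) (M : ℕ) {r : ℝ}
    (hr : 0 < r) {φ : ℝ} (hφ : |φ - ε * M * Real.pi| < Real.pi) (S : ℂ) :
    mbFormula N ε M c r φ S = mbCore ε M r φ + S := by
  have hsq : ((-1 : ℂ) ^ M) ^ 2 = 1 := by rw [← pow_mul, mul_comm, pow_mul, neg_one_sq, one_pow]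
  rw [mbFormula, mbIntegral_eq, mbCore,
    logGamma_eq_stirlingLog hN hc h0 h1 (point_mem_slitPlane hr hφ), stirlingLog,
    log_point hr hφ, leadingTerms, leadingTerms, point_sub hε, truncatedSeries_neg_one_pow_mul]
  linear_combination -(truncatedSeries N (point r φ) + point r φ *
    mbLine c (Real.log (2 * Real.pi) + surfaceLog r (φ - ε * M * Real.pi))) * hsq

/-- The rotated point is z again; the two leading terms differ by 2kεπi (z - 1/2). -/
lemma mbCore_even {ε : ℝ} (hε : ε = 1 ∨ ε = -1) (k : ℕ) (r φ : ℝ) :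
    mbCore ε (2 * k) r φ = logGamma (point r φ) +
      (Complex.I * ε * Real.pi * (2 * k : ℕ) * point r φ - Complex.I * ε * Real.pi * k) := by
  rw [mbCore, leadingTerms, leadingTerms, point_sub hε, surfaceLog, surfaceLog]
  simp only [pow_mul, neg_one_sq, one_pow, one_mul]
  push_cast
  ring

/-- The rotated point is -z; in F(z) + F(-z) the products z ln z cancel, leaving ln(2π) - ln z and
(2k+1)επi (z + 1/2). -/
lemma mbCore_odd {ε : ℝ} (hε : ε = 1 ∨ ε = -1) (k : ℕ) (r φ : ℝ) :
    mbCore ε (2 * k + 1) r φ = (Real.log (2 * Real.pi) : ℂ) - surfaceLog r φ -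
      logGamma (-point r φ) + Complex.I * ε * Real.pi * (2 * k : ℕ) * point r φ +
      Complex.I * ε * Real.pi * point r φ +
      Complex.I * ε * Real.pi * k + Complex.I * ε * (Real.pi / 2) := by
  have hp : (-1 : ℂ) ^ (2 * k + 1) = -1 := Odd.neg_one_pow ⟨k, rfl⟩
  rw [mbCore, leadingTerms, leadingTerms, point_sub hε, surfaceLog, surfaceLog, hp, neg_one_mul]
  push_cast
  ring_nf

lemma sMB_even (ε : ℝ) (k : ℕ) (z : ℂ) :
    sMB ε (2 * k) z = ε * k * Complex.log (-Complex.exp (-2 * Complex.I * Real.pi * z)) := by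
  simp [sMB]

lemma sMB_odd (ε : ℝ) (k : ℕ) (z : ℂ) :
    sMB ε (2 * k + 1) z = ε * k * Complex.log (-Complex.exp (-2 * Complex.I * Real.pi * z)) -
      Complex.log (1 - Complex.exp (ε * 2 * Complex.I * Real.pi * z)) := by
  have : (2 * k + 1) / 2 = k := by omega
  simp [sMB, this, pow_succ]

lemma exp_sign_mul_log {ε : ℝ} (hε : ε = 1 ∨ ε = -1) (k : ℕ) (z : ℂ) :
    Complex.exp (ε * k * Complex.log (-Complex.exp (-2 * Complex.I * Real.pi * z))) =
      (-1) ^ k * (Complex.exp (Complex.I * ε * Real.pi * (2 * k : ℕ) * z))⁻¹ := by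
  have hne : -Complex.exp (-2 * Complex.I * Real.pi * z) ≠ 0 := neg_ne_zero.mpr (Complex.exp_ne_zero _)
  have h : Complex.exp (k * Complex.log (-Complex.exp (-2 * Complex.I * Real.pi * z))) =
      (-1) ^ k * (Complex.exp (Complex.I * Real.pi * (2 * k : ℕ) * z))⁻¹ := by
    rw [Complex.exp_nat_mul, Complex.exp_log hne, neg_pow, ← Complex.exp_nat_mul, ← Complex.exp_neg]
    congr 2
    push_cast
    ring
  rcases hε with rfl | rfl
  · simpa using h
  · rw [show ((-1 : ℝ) : ℂ) * k * Complex.log (-Complex.exp (-2 * Complex.I * Real.pi * z)) =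
      -(k * Complex.log (-Complex.exp (-2 * Complex.I * Real.pi * z))) by push_cast; ring,
      Complex.exp_neg, h, mul_inv, ← inv_pow, inv_neg_one, inv_inv, ← Complex.exp_neg]
    congr 2
    push_cast
    ring

lemma Gamma_reflection_neg {z : ℂ} (hz : z ≠ 0) (hG : Complex.Gamma (-z) ≠ 0)
    (hsin : Complex.sin (Real.pi * z) ≠ 0) :
    Complex.Gamma z = -Real.pi / (z * Complex.Gamma (-z) * Complex.sin (Real.pi * z)) := by
  have h := Complex.Gamma_mul_Gamma_one_sub (-z)
  rw [sub_neg_eq_add, add_comm 1 z, Complex.Gamma_add_one z hz, mul_neg, Complex.sin_neg] at h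
  rw [eq_div_iff (neg_ne_zero.mpr hsin)] at h
  rw [eq_div_iff (mul_ne_zero (mul_ne_zero hz hG) hsin)]
  linear_combination -h

/-- For even M the power of -e^{-2πiz} cancels the branch shift. For odd M there is in addition the
reflection formula, with 1 - e^{2εiπz} = -2εi sin(πz) e^{εiπz}. -/
lemma exp_mbCore_add_sMB {ε : ℝ} (hε : ε = 1 ∨ ε = -1) (M : ℕ) {r : ℝ}
    (hr : 0 < r) {φ : ℝ} (hφ : |φ - ε * M * Real.pi| < Real.pi)
    (hpole : ∀ n : ℕ, point r φ ≠ -(n : ℂ)) :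
    Complex.exp (mbCore ε M r φ + sMB ε M (point r φ)) = Complex.Gamma (point r φ) := by
  have hslit := point_mem_slitPlane hr hφ
  rw [point_sub hε] at hslit
  rcases Nat.even_or_odd' M with ⟨k, rfl | rfl⟩
  · rw [pow_mul, neg_one_sq, one_pow, one_mul] at hslit
    rw [mbCore_even hε, sMB_even, Complex.exp_add, Complex.exp_add, Complex.exp_sub,
      exp_sign_mul_log hε, exp_sign_mul_pi hε, exp_logGamma hslit]
    have h1 := Complex.exp_ne_zero (Complex.I * ε * Real.pi * (2 * k : ℕ) * point r φ)
    have h2 : ((-1 : ℂ)) ^ k ≠ 0 := pow_ne_zero _ (by norm_num)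
    field_simp
  · rw [pow_succ, pow_mul, neg_one_sq, one_pow, one_mul, neg_one_mul] at hslit
    have hz := point_ne_zero hr φ
    set z := point r φ with hzdef
    -- An integer z ≤ 0 is excluded as a pole, and z > 0 because -z lies in the slit plane.
    have hsin : Complex.sin (Real.pi * z) ≠ 0 := by
      intro h
      rw [Complex.sin_eq_zero_iff] at h
      obtain ⟨n, hn⟩ := h
      rw [mul_comm] at hn
      have hn := mul_right_cancel₀ (by exact_mod_cast Real.pi_ne_zero : (Real.pi : ℂ) ≠ 0) hn
      rcases le_or_gt n 0 with h0 | h0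
      · obtain ⟨m, hm⟩ := Int.exists_eq_neg_ofNat h0
        apply hpole m
        rw [hn, hm]
        push_cast
        rfl
      · rw [hn, ← Complex.ofReal_intCast, ← Complex.ofReal_neg, Complex.ofReal_mem_slitPlane] at hslit
        have : (0 : ℝ) < n := by exact_mod_cast h0
        linarith
    have hG : Complex.Gamma (-z) ≠ 0 := by
      rw [← exp_logGamma hslit]; exact Complex.exp_ne_zero _
    have hε0 : (ε : ℂ) ≠ 0 := by rcases hε with rfl | rfl <;> norm_num
    have hfac : 1 - Complex.exp (ε * 2 * Complex.I * Real.pi * z) =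
        -2 * ε * Complex.I * Complex.sin (Real.pi * z) * Complex.exp (Complex.I * ε * Real.pi * z) := by
      have h1 : Complex.sin (Real.pi * z) * ε = Complex.sin (ε * (Real.pi * z)) := by
        rcases hε with rfl | rfl <;> simp
      rw [show -2 * ε * Complex.I * Complex.sin (Real.pi * z) =
        -2 * Complex.I * (Complex.sin (Real.pi * z) * ε) by ring, h1, Complex.sin]
      rw [show -(ε * (Real.pi * z)) * Complex.I = -(Complex.I * ε * Real.pi * z) by ring,
        show ε * (Real.pi * z) * Complex.I = Complex.I * ε * Real.pi * z by ring,
        show ε * 2 * Complex.I * Real.pi * z =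
          Complex.I * ε * Real.pi * z + Complex.I * ε * Real.pi * z by ring, Complex.exp_add,
        Complex.exp_neg]
      have h2 := Complex.exp_ne_zero (Complex.I * ε * Real.pi * z)
      field_simp
      linear_combination (1 - Complex.exp (Complex.I * ε * Real.pi * z) ^ 2) * Complex.I_sq
    have hne : 1 - Complex.exp (ε * 2 * Complex.I * Real.pi * z) ≠ 0 := by
      rw [hfac]
      exact mul_ne_zero (mul_ne_zero (mul_ne_zero (mul_ne_zero (by norm_num) hε0) Complex.I_ne_zero)
        hsin) (Complex.exp_ne_zero _)
    rw [mbCore_odd hε, sMB_odd, ← hzdef, Complex.exp_add, Complex.exp_sub (ε * k * _),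
      Complex.exp_log hne, hfac,
      Complex.exp_add, Complex.exp_add, Complex.exp_add, Complex.exp_add, Complex.exp_sub,
      Complex.exp_sub, exp_sign_mul_log hε, exp_sign_mul_pi hε, exp_sign_mul_pi_div_two hε,
      exp_logGamma hslit, ← point_eq_exp hr, ← Complex.ofReal_exp,
      Real.exp_log (by have := Real.pi_pos; positivity), Gamma_reflection_neg hz hG hsin]
    have h1 := Complex.exp_ne_zero (Complex.I * ε * Real.pi * (2 * k : ℕ) * z)
    have h2 := Complex.exp_ne_zero (Complex.I * ε * Real.pi * z)
    have h3 : ((-1 : ℂ) ^ k) ^ 2 = 1 := by rw [← pow_mul, mul_comm, pow_mul, neg_one_sq, one_pow]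
    have h4 := Complex.I_ne_zero
    push_cast at h1 ⊢
    rw [← hzdef]
    field_simp
    rw [h3]

lemma continuousAt_logGamma_point {r φ : ℝ} (hr : 0 < r) (hφ : |φ| < Real.pi) :
    ContinuousAt (fun φ => logGamma (point r φ)) φ :=
  ContinuousAt.comp (g := logGamma) (continuousAt_logGamma (point_mem_slitPlane hr hφ))
    (continuous_point r).continuousAt

lemma continuousAt_mbCore (ε : ℝ) (M : ℕ) {r φ : ℝ} (hr : 0 < r)
    (hφ : |φ - ε * M * Real.pi| < Real.pi) : ContinuousAt (mbCore ε M r) φ := by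
  have h1 : ContinuousAt (fun φ => logGamma (point r (φ - ε * M * Real.pi))) φ :=
    ContinuousAt.comp (f := fun φ : ℝ => φ - ε * M * Real.pi) (continuousAt_logGamma_point hr hφ)
      (by fun_prop)
  have h2 := continuous_leadingTerms r
  unfold mbCore
  refine h2.continuousAt.add (continuousAt_const.mul (h1.sub ?_))
  exact (h2.comp (by fun_prop : Continuous fun φ : ℝ => φ - ε * M * Real.pi)).continuousAt

/-! ### Identification of the principal value. -/

lemma point_im (r φ : ℝ) : (point r φ).im = r * Real.sin φ := by
  rw [point, Complex.im_ofReal_mul, Complex.exp_ofReal_mul_I_im]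

lemma point_re (r φ : ℝ) : (point r φ).re = r * Real.cos φ := by
  rw [point, Complex.re_ofReal_mul, Complex.exp_ofReal_mul_I_re]

/-- A continuous function on a connected set with values in `2πiℤ` is constant. -/
lemma eq_of_exp_eq_one {S : Set ℝ} (hS : IsPreconnected S) {D : ℝ → ℂ} (hD : ContinuousOn D S)
    (hexp : ∀ φ ∈ S, Complex.exp (D φ) = 1) {a b : ℝ} (ha : a ∈ S) (hb : b ∈ S) : D a = D b := by
  have hpi : (2 * Real.pi * Complex.I : ℂ) ≠ 0 := Complex.two_pi_I_ne_zero
  have hint : ∀ φ ∈ S, ∃ n : ℤ, D φ = n * (2 * Real.pi * Complex.I) := fun φ hφ =>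
    Complex.exp_eq_one_iff.mp (hexp φ hφ)
  set g : ℝ → ℝ := fun φ => (D φ / (2 * Real.pi * Complex.I)).re with hg
  have hgD : ∀ φ ∈ S, D φ = g φ * (2 * Real.pi * Complex.I) ∧ g φ ∈ range ((↑) : ℤ → ℝ) := by
    intro φ hφ
    obtain ⟨n, hn⟩ := hint φ hφ
    have : g φ = n := by simp only [hg]; rw [hn, mul_div_cancel_right₀ _ hpi, Complex.intCast_re]
    rw [this]
    exact ⟨by rw [hn]; simp, n, rfl⟩
  have hgc : ContinuousOn g S := Complex.continuous_re.comp_continuousOn (hD.div_const _)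
  have hdisc : DiscreteTopology (range ((↑) : ℤ → ℝ)) :=
    (Int.isClosedEmbedding_coe_real.isEmbedding.toHomeomorph).symm.isEmbedding.discreteTopology
  have := hS.constant_of_mapsTo ⟨hdisc⟩ hgc (fun φ hφ => (hgD φ hφ).2) ha hb
  rw [(hgD a ha).1, (hgD b hb).1, this]

lemma sign_mul_self {ε : ℝ} (hε : ε = 1 ∨ ε = -1) : ε * ε = 1 := by
  rcases hε with rfl | rfl <;> norm_num

lemma isPreconnected_sign_mul_mem_Ioo {ε : ℝ} (hε : ε = 1 ∨ ε = -1) :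
    IsPreconnected {φ : ℝ | 0 < ε * φ ∧ ε * φ < Real.pi} := by
  rw [isPreconnected_iff_ordConnected]
  refine ⟨fun x hx y hy z hz => ?_⟩
  simp only [mem_ofPred_eq] at hx hy ⊢
  rcases hε with rfl | rfl
  · constructor <;> linarith [hz.1, hz.2]
  · constructor <;> linarith [hz.1, hz.2]

/-- Both sides are continuous logarithms of Γ on a half circle, so they differ by a constant in
2πiℤ. At z = εir this constant is real, hence 0. -/
lemma mbCore_one_add_sMB_principal {ε : ℝ} (hε : ε = 1 ∨ ε = -1) {r φ : ℝ} (hr : 0 < r)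
    (hφ : 0 < ε * φ) (hφ' : ε * φ < Real.pi) :
    mbCore ε 1 r φ + sMB ε 1 (point r φ) = logGamma (point r φ) := by
  have hpi := Real.pi_pos
  have hεε := sign_mul_self hε
  set S : Set ℝ := {φ : ℝ | 0 < ε * φ ∧ ε * φ < Real.pi} with hSdef
  have habs : ∀ ψ ∈ S, |ψ| < Real.pi ∧ |ψ - ε * (1 : ℕ) * Real.pi| < Real.pi ∧
      0 < ε * Real.sin ψ := by
    intro ψ hψ
    have hψ1 := hψ.1
    have hψ2 := hψ.2
    have hs : ε * Real.sin ψ = Real.sin (ε * ψ) := by rcases hε with rfl | rfl <;> simp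
    refine ⟨?_, ?_, by rw [hs]; exact Real.sin_pos_of_pos_of_lt_pi hψ1 hψ2⟩
    · rw [abs_lt]; rcases hε with rfl | rfl <;> constructor <;> linarith
    · rw [abs_lt]; rcases hε with rfl | rfl <;> push_cast <;> constructor <;> linarith
  -- Hence 1 - e^{2εiπz} stays in the slit plane and its logarithm is continuous along the arc.
  have hnorm : ∀ ψ ∈ S,
      ‖Complex.exp (ε * 2 * Complex.I * Real.pi * point r ψ)‖ < 1 := by
    intro ψ hψ
    rw [Complex.norm_exp, Real.exp_lt_one_iff]
    have : (ε * 2 * Complex.I * Real.pi * point r ψ).re = -(2 * Real.pi * r * (ε * Real.sin ψ)) := by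
      rw [show ε * 2 * Complex.I * Real.pi * point r ψ =
        ((ε * 2 * Real.pi : ℝ) : ℂ) * (point r ψ * Complex.I) by push_cast; ring,
        Complex.re_ofReal_mul, Complex.mul_I_re, point_im]
      ring
    rw [this]
    have := (habs ψ hψ).2.2
    have : 0 < 2 * Real.pi * r * (ε * Real.sin ψ) := by positivity
    linarith
  have hsMB : ∀ z, sMB ε 1 z =
      -Complex.log (1 - Complex.exp (ε * 2 * Complex.I * Real.pi * z)) := by
    intro z
    have := sMB_odd ε 0 z
    simpa using this
  set D : ℝ → ℂ := fun ψ => mbCore ε 1 r ψ + sMB ε 1 (point r ψ) - logGamma (point r ψ) with hD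
  have hDc : ContinuousOn D S := by
    intro ψ hψ
    refine ContinuousAt.continuousWithinAt ?_
    refine ((continuousAt_mbCore ε 1 hr (habs ψ hψ).2.1).add ?_).sub
      (continuousAt_logGamma_point hr (habs ψ hψ).1)
    simp_rw [hsMB]
    refine ContinuousAt.neg (ContinuousAt.clog ?_ ?_)
    · have := continuous_point r
      fun_prop
    · have := Complex.mem_slitPlane_of_norm_lt_one (by rw [norm_neg]; exact hnorm ψ hψ)
      rwa [← sub_eq_add_neg] at this
  have hDexp : ∀ ψ ∈ S, Complex.exp (D ψ) = 1 := by
    intro ψ hψ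
    have hslit := point_mem_slitPlane hr (habs ψ hψ).1
    simp only [hD]
    rw [Complex.exp_sub, exp_mbCore_add_sMB hε 1 hr (habs ψ hψ).2.1, exp_logGamma hslit, div_self]
    · rw [← exp_logGamma hslit]; exact Complex.exp_ne_zero _
    · intro n h
      have h := congrArg Complex.im h
      rw [point_im] at h
      have h2 := (habs ψ hψ).2.2
      simp [hr.ne'] at h
      rw [h] at h2
      simp at h2
  have hmid : ε * (Real.pi / 2) ∈ S := by
    constructor <;> rw [← mul_assoc, hεε] <;> linarith
  have hDmid : D (ε * (Real.pi / 2)) = 0 := by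
    have hz : point r (ε * (Real.pi / 2)) = r * (ε * Complex.I) := by
      rw [point, ← exp_sign_mul_pi_div_two hε]
      congr 2
      push_cast
      ring
    have hconj : -point r (ε * (Real.pi / 2)) =
        (starRingEnd ℂ) (point r (ε * (Real.pi / 2))) := by
      rw [hz]; simp
    -- Here ln Γ(-z) + ln Γ(z) is a sum of conjugates, and the iεπ/2 in ln z cancels the one in
    -- `mbCore_odd`.
    have him : (D (ε * (Real.pi / 2))).im = 0 := by
      have hcore := mbCore_odd hε 0 r (ε * (Real.pi / 2))
      simp only [hD]
      rw [show mbCore ε 1 r (ε * (Real.pi / 2)) = _ from hcore, hconj, logGamma_conj, hsMB, hz]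
      have e1 : ε * 2 * Complex.I * Real.pi * (r * (ε * Complex.I)) =
          ((-(2 * Real.pi * r) : ℝ) : ℂ) := by
        push_cast
        linear_combination (2 * Real.pi * r * Complex.I ^ 2) * sign_sq hε +
          2 * Real.pi * r * Complex.I_sq
      have e2 : Complex.I * ε * Real.pi * (r * (ε * Complex.I)) = ((-(Real.pi * r) : ℝ) : ℂ) := by
        push_cast
        linear_combination (Real.pi * r * Complex.I ^ 2) * sign_sq hε + Real.pi * r * Complex.I_sq
      have e3 : (Complex.log (1 - Complex.exp ((-(2 * Real.pi * r) : ℝ) : ℂ))).im = 0 := by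
        have hlt : Real.exp (-(2 * Real.pi * r)) < 1 := Real.exp_lt_one_iff.mpr (by
          have : 0 < 2 * Real.pi * r := by positivity
          linarith)
        rw [← Complex.ofReal_exp, ← Complex.ofReal_one, ← Complex.ofReal_sub,
          ← Complex.ofReal_log (by linarith), Complex.ofReal_im]
      rw [e1, e2, surfaceLog]
      simp only [Complex.sub_im, Complex.add_im, Complex.neg_im, e3, Complex.ofReal_im,
        Complex.conj_im]
      simp
    obtain ⟨n, hn⟩ := Complex.exp_eq_one_iff.mp (hDexp _ hmid)
    rw [hn] at him ⊢
    have : n = 0 := by simpa [hpi.ne'] using him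
    simp [this]
  have := eq_of_exp_eq_one (isPreconnected_sign_mul_mem_Ioo hε) hDc hDexp
    (show φ ∈ S from ⟨hφ, hφ'⟩) hmid
  rw [hDmid] at this
  exact sub_eq_zero.mp this

lemma mbCore_add_sMB_principal {ε : ℝ} (hε : ε = 1 ∨ ε = -1) (M : ℕ) {r : ℝ}
    (hr : 0 < r) {φ : ℝ} (hφ : |φ - ε * M * Real.pi| < Real.pi) (hφ' : |φ| < Real.pi) :
    mbCore ε M r φ + sMB ε M (point r φ) = logGamma (point r φ) := by
  have hpi := Real.pi_pos
  rw [abs_lt] at hφ hφ'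
  -- Intervals of half-length π about 0 and εMπ are disjoint once M ≥ 2.
  have hM : M < 2 := by
    by_contra hM
    push Not at hM
    have : (2 : ℝ) ≤ M := by exact_mod_cast hM
    rcases hε with rfl | rfl <;> nlinarith [hφ.1, hφ.2, hφ'.1, hφ'.2]
  interval_cases M
  · have h1 := mbCore_even hε 0 r φ
    have h2 := sMB_even ε 0 (point r φ)
    simp only [mul_zero, Nat.cast_zero, zero_mul, sub_zero, add_zero] at h1 h2
    rw [h1, h2, add_zero]
  · refine mbCore_one_add_sMB_principal hε hr ?_ ?_
    · rcases hε with rfl | rfl <;> push_cast at hφ <;> linarith [hφ.1, hφ.2, hφ'.1, hφ'.2]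
    · rcases hε with rfl | rfl <;> linarith [hφ'.1, hφ'.2]

/-- The formula for `ln Γ` off the poles. -/
lemma isLnGamma_mbCore_add_sMB {ε : ℝ} (hε : ε = 1 ∨ ε = -1) (M : ℕ) {r : ℝ}
    (hr : 0 < r) {φ : ℝ} (hφ : |φ - ε * M * Real.pi| < Real.pi)
    (hpole : ∀ n : ℕ, point r φ ≠ -(n : ℂ)) :
    IsLnGamma r φ (mbCore ε M r φ + sMB ε M (point r φ)) :=
  ⟨exp_mbCore_add_sMB hε M hr hφ hpole, mbCore_add_sMB_principal hε M hr hφ⟩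

/-! ### One-sided limits of S_MB on the imaginary axis. -/

lemma ne_neg_natCast_of_im_ne_zero {z : ℂ} (hz : z.im ≠ 0) (n : ℕ) : z ≠ -(n : ℂ) := by
  rintro rfl
  simp at hz

/-- Limits of `S_MB` give values of `ln Γ` off the real axis. -/
lemma isLnGamma_of_tendsto_sMB {ε : ℝ} (hε : ε = 1 ∨ ε = -1) (M : ℕ) {r : ℝ}
    (hr : 0 < r) {θ : ℝ} (hθ : |θ - ε * M * Real.pi| < Real.pi) (him : (point r θ).im ≠ 0)
    {l : Filter ℝ} [l.NeBot] (hl : l ≤ 𝓝 θ) {A : ℂ}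
    (hA : Tendsto (fun φ => sMB ε M (point r φ)) l (𝓝 A)) :
    IsLnGamma r θ (mbCore ε M r θ + A) := by
  have hlim : Tendsto (fun φ => mbCore ε M r φ + sMB ε M (point r φ)) l
      (𝓝 (mbCore ε M r θ + A)) := ((continuousAt_mbCore ε M hr hθ).tendsto.mono_left hl).add hA
  have hev : ∀ᶠ φ in l, |φ - ε * M * Real.pi| < Real.pi ∧ (point r φ).im ≠ 0 := by
    have h1 : ∀ᶠ φ in 𝓝 θ, |φ - ε * M * Real.pi| < Real.pi :=
      ContinuousAt.eventually_lt (by fun_prop) continuousAt_const hθ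
    have h2 : ∀ᶠ φ in 𝓝 θ, (point r φ).im ≠ 0 :=
      (Complex.continuous_im.comp (continuous_point r)).continuousAt.eventually_ne him
    exact hl (h1.and h2)
  have hpt : Tendsto (point r) l (𝓝 (point r θ)) :=
    (continuous_point r).continuousAt.tendsto.mono_left hl
  refine ⟨?_, fun hπ => ?_⟩
  · have h1 := (Complex.continuous_exp.tendsto _).comp hlim
    have h2 : Tendsto (fun φ => Complex.Gamma (point r φ)) l (𝓝 (Complex.Gamma (point r θ))) :=
      ((Complex.differentiableAt_Gamma _
        (ne_neg_natCast_of_im_ne_zero him)).continuousAt.tendsto).comp hpt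
    refine tendsto_nhds_unique (h1.congr' ?_) h2
    filter_upwards [hev] with φ hφ
    exact exp_mbCore_add_sMB hε M hr hφ.1 (ne_neg_natCast_of_im_ne_zero hφ.2)
  · have h2 : Tendsto (fun φ => logGamma (point r φ)) l (𝓝 (logGamma (point r θ))) :=
      (continuousAt_logGamma_point hr hπ).tendsto.mono_left hl
    refine tendsto_nhds_unique (hlim.congr' ?_) h2
    have hev2 : ∀ᶠ φ in l, |φ| < Real.pi :=
      hl (ContinuousAt.eventually_lt (by fun_prop) continuousAt_const hπ)
    filter_upwards [hev, hev2] with φ hφ hφ2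
    exact mbCore_add_sMB_principal hε M hr hφ.1 hφ2

/-- One-sided limits of the principal logarithm at a point of its branch cut. -/
lemma tendsto_log_of_im_sign {f : ℝ → ℂ} {l : Filter ℝ} {q : ℝ} (hq : 0 < q)
    (hf : Tendsto f l (𝓝 (-(q : ℂ)))) {σ : ℝ} (hσ : σ = 1 ∨ σ = -1)
    (him : ∀ᶠ φ in l, 0 < σ * (f φ).im) :
    Tendsto (fun φ => Complex.log (f φ)) l (𝓝 (Real.log q + σ * Real.pi * Complex.I)) := by
  have hre : (-(q : ℂ)).re < 0 := by simpa using hq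
  have him0 : (-(q : ℂ)).im = 0 := by simp
  have hn : ‖-(q : ℂ)‖ = q := by rw [norm_neg, Complex.norm_real, Real.norm_of_nonneg hq.le]
  rcases hσ with rfl | rfl
  · have h := Complex.tendsto_log_nhdsWithin_im_nonneg_of_re_neg_of_im_zero hre him0
    rw [hn] at h
    rw [Complex.ofReal_one, one_mul]
    refine h.comp (tendsto_nhdsWithin_iff.mpr ⟨hf, ?_⟩)
    filter_upwards [him] with φ hφ
    simpa using hφ.le
  · have h := Complex.tendsto_log_nhdsWithin_im_neg_of_re_neg_of_im_zero hre him0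
    rw [hn] at h
    rw [show (Real.log q + ((-1 : ℝ) : ℂ) * Real.pi * Complex.I : ℂ) =
      Real.log q - Real.pi * Complex.I by push_cast; ring]
    refine h.comp (tendsto_nhdsWithin_iff.mpr ⟨hf, ?_⟩)
    filter_upwards [him] with φ hφ
    simpa using hφ

lemma exp_two_pi_I_mul_im (a : ℝ) (z : ℂ) :
    (Complex.exp (a * (2 * Real.pi * Complex.I * z))).im =
      Real.exp (-(2 * Real.pi * a * z.im)) * Real.sin (2 * Real.pi * (a * z.re)) := by
  rw [Complex.exp_im]
  congr 2 <;> simp <;> ring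

/-- Decides on which side of the cut the logarithms in S_MB lie when Re z is small. -/
lemma sin_two_pi_mul_sign {x σ : ℝ} (hσ : σ = 1 ∨ σ = -1) (h : 0 < σ * x) (h' : |x| < 1 / 2) :
    0 < σ * Real.sin (2 * Real.pi * x) := by
  have hpi := Real.pi_pos
  rw [abs_lt] at h'
  have : σ * Real.sin (2 * Real.pi * x) = Real.sin (2 * Real.pi * (σ * x)) := by
    rcases hσ with rfl | rfl <;> simp
  rw [this]
  refine Real.sin_pos_of_pos_of_lt_pi (by positivity) ?_
  have : σ * x < 1 / 2 := by rcases hσ with rfl | rfl <;> linarith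
  nlinarith

section OneSided

variable {r θ q σ : ℝ} {l : Filter ℝ}

lemma eventually_abs_point_re_lt (hl : l ≤ 𝓝 θ) (hq : point r θ = Complex.I * q) :
    ∀ᶠ φ in l, |(point r φ).re| < 1 / 2 := by
  refine hl (ContinuousAt.eventually_lt ?_ continuousAt_const ?_)
  · exact (Complex.continuous_re.comp (continuous_point r)).abs.continuousAt
  · simp [hq]

lemma tendsto_exp_point (a : ℝ) (hl : l ≤ 𝓝 θ) (hq : point r θ = Complex.I * q) :
    Tendsto (fun φ => Complex.exp (a * (2 * Real.pi * Complex.I * point r φ))) l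
      (𝓝 ((Real.exp (-(2 * Real.pi * a * q)) : ℝ) : ℂ)) := by
  have h : Continuous fun φ => Complex.exp (a * (2 * Real.pi * Complex.I * point r φ)) := by
    have := continuous_point r
    fun_prop
  have h2 := (h.tendsto θ).mono_left hl
  rw [hq, show (a * (2 * Real.pi * Complex.I * (Complex.I * q)) : ℂ) =
    ((-(2 * Real.pi * a * q) : ℝ) : ℂ) by
      push_cast; linear_combination 2 * Real.pi * a * q * Complex.I_sq, ← Complex.ofReal_exp] at h2
  exact h2

/-- On the imaginary axis -e^{-2πiz} is a negative real; nearby, its imaginary part has the sign of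
Re z. -/
lemma tendsto_log_neg_exp (hl : l ≤ 𝓝 θ) (hq : point r θ = Complex.I * q)
    (hσ : σ = 1 ∨ σ = -1) (hre : ∀ᶠ φ in l, 0 < σ * (point r φ).re) :
    Tendsto (fun φ => Complex.log (-Complex.exp (-2 * Complex.I * Real.pi * point r φ))) l
      (𝓝 (2 * Real.pi * q + σ * Real.pi * Complex.I)) := by
  have e : ∀ φ, -2 * Complex.I * Real.pi * point r φ =
      ((-1 : ℝ) : ℂ) * (2 * Real.pi * Complex.I * point r φ) := by
    intro φ; push_cast; ring
  simp_rw [e]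
  have h := tendsto_log_of_im_sign (Real.exp_pos _) (tendsto_exp_point (-1) hl hq).neg hσ (by
    filter_upwards [hre, eventually_abs_point_re_lt hl hq] with φ h1 h2
    rw [Complex.neg_im, exp_two_pi_I_mul_im,
      show 2 * Real.pi * (-1 * (point r φ).re) = -(2 * Real.pi * (point r φ).re) by ring,
      Real.sin_neg]
    have h3 := mul_pos (Real.exp_pos (-(2 * Real.pi * -1 * (point r φ).im)))
      (sin_two_pi_mul_sign hσ h1 h2)
    linarith)
  rw [Real.log_exp] at h
  convert h using 2
  push_cast
  ring

/-- Here 1 - e^{-2πεq} > 0 is off the cut, so there is no jump. -/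
lemma tendsto_log_one_sub_exp_of_pos {ε : ℝ} (hl : l ≤ 𝓝 θ) (hq : point r θ = Complex.I * q)
    (hεq : 0 < ε * q) :
    Tendsto (fun φ => Complex.log (1 - Complex.exp (ε * 2 * Complex.I * Real.pi * point r φ))) l
      (𝓝 (Real.log (1 - Real.exp (-(2 * Real.pi * (ε * q)))) : ℂ)) := by
  have hpi := Real.pi_pos
  have e : ∀ φ, ε * 2 * Complex.I * Real.pi * point r φ =
      ε * (2 * Real.pi * Complex.I * point r φ) := fun φ => by ring
  simp_rw [e]
  have hlt : Real.exp (-(2 * Real.pi * (ε * q))) < 1 := Real.exp_lt_one_iff.mpr (by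
    have : 0 < 2 * Real.pi * (ε * q) := by positivity
    linarith)
  have h := (tendsto_exp_point ε hl hq).const_sub 1
  rw [mul_assoc (2 * Real.pi) ε q, ← Complex.ofReal_one, ← Complex.ofReal_sub] at h
  rw [Complex.ofReal_log (by linarith)]
  exact h.clog (Complex.ofReal_mem_slitPlane.mpr (by linarith))

/-- Now the limit 1 - e^{-2πεq} is negative, and the argument approaches it with imaginary part of
sign -εσ. -/
lemma tendsto_log_one_sub_exp_of_neg {ε : ℝ} (hε : ε = 1 ∨ ε = -1) (hl : l ≤ 𝓝 θ)
    (hq : point r θ = Complex.I * q) (hεq : ε * q < 0)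
    (hσ : σ = 1 ∨ σ = -1) (hre : ∀ᶠ φ in l, 0 < σ * (point r φ).re) :
    Tendsto (fun φ => Complex.log (1 - Complex.exp (ε * 2 * Complex.I * Real.pi * point r φ))) l
      (𝓝 (Real.log (Real.exp (-(2 * Real.pi * (ε * q))) - 1) - ε * σ * Real.pi * Complex.I)) := by
  have hpi := Real.pi_pos
  have e : ∀ φ, ε * 2 * Complex.I * Real.pi * point r φ =
      ε * (2 * Real.pi * Complex.I * point r φ) := fun φ => by ring
  simp_rw [e]
  have hlt : 1 < Real.exp (-(2 * Real.pi * (ε * q))) := Real.one_lt_exp_iff.mpr (by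
    have : 0 < 2 * Real.pi * (-(ε * q)) := mul_pos (by positivity) (by linarith)
    linarith)
  have hf := (tendsto_exp_point ε hl hq).const_sub 1
  rw [mul_assoc (2 * Real.pi) ε q, ← neg_sub, ← Complex.ofReal_one, ← Complex.ofReal_sub] at hf
  have hεσ : -(ε * σ) = 1 ∨ -(ε * σ) = -1 := by
    rcases hε with rfl | rfl <;> rcases hσ with rfl | rfl <;> norm_num
  have h := tendsto_log_of_im_sign (sub_pos.mpr hlt) hf hεσ (by
    filter_upwards [hre, eventually_abs_point_re_lt hl hq] with φ h1 h2
    rw [Complex.sub_im, Complex.ofReal_im, exp_two_pi_I_mul_im]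
    have hs : Real.sin (2 * Real.pi * (ε * (point r φ).re)) =
        ε * Real.sin (2 * Real.pi * (point r φ).re) := by
      rcases hε with rfl | rfl <;> simp
    have h3 := mul_pos (Real.exp_pos (-(2 * Real.pi * ε * (point r φ).im)))
      (sin_two_pi_mul_sign hσ h1 h2)
    rw [hs]
    linear_combination h3 + (-(Real.exp (-(2 * Real.pi * ε * (point r φ).im)) *
      (σ * Real.sin (2 * Real.pi * (point r φ).re)))) * sign_mul_self hε)
  rw [Complex.ofReal_one] at h
  convert h using 2
  push_cast
  ring

end OneSided

/-- If `cos θ = 0`, the real part of `r e^{iφ}` changes sign at `φ = θ`. -/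
lemma exists_sign_point_re {r θ : ℝ} (hr : 0 < r) (hθ : Real.cos θ = 0) :
    ∃ σ : ℝ, (σ = 1 ∨ σ = -1) ∧ (∀ᶠ φ in 𝓝[>] θ, 0 < σ * (point r φ).re) ∧
      ∀ᶠ φ in 𝓝[<] θ, 0 < -σ * (point r φ).re := by
  have hpi := Real.pi_pos
  have hsq : Real.sin θ * Real.sin θ = 1 := by
    have := Real.sin_sq_add_cos_sq θ
    rw [hθ] at this
    linarith
  have hcos : ∀ φ, -Real.sin θ * (point r φ).re = r * Real.sin (φ - θ) := by
    intro φ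
    rw [point_re, show φ = θ + (φ - θ) by ring, Real.cos_add, hθ, add_sub_cancel_left]
    linear_combination r * Real.sin (φ - θ) * hsq
  -- This is the slope of cos at its zero θ.
  refine ⟨-Real.sin θ, ?_, ?_, ?_⟩
  · rcases mul_self_eq_one_iff.mp hsq with h | h <;> simp [h]
  · filter_upwards [Ioo_mem_nhdsGT (show θ < θ + Real.pi by linarith)] with φ hφ
    rw [hcos]
    exact mul_pos hr (Real.sin_pos_of_pos_of_lt_pi (by linarith [hφ.1]) (by linarith [hφ.2]))
  · filter_upwards [Ioo_mem_nhdsLT (show θ - Real.pi < θ by linarith)] with φ hφ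
    rw [neg_mul, hcos, ← mul_neg, ← Real.sin_neg]
    exact mul_pos hr (Real.sin_pos_of_pos_of_lt_pi (by linarith [hφ.2]) (by linarith [hφ.1]))

/-- If the one-sided limits of `S_MB` are symmetric about `S`, then the formula with `S` is the
mid-point value. -/
lemma isMidpointLnGamma_of_sMB {N : ℕ} (hN : 1 ≤ N) {c : ℝ} (hc : 1 / 2 < c)
    (h0 : (N : ℝ) - 1 < c) (h1 : c < N) {ε : ℝ} (hε : ε = 1 ∨ ε = -1) (M : ℕ) {r : ℝ}
    (hr : 0 < r) {θ q : ℝ} (hθ : |θ - ε * M * Real.pi| < Real.pi) (hq0 : q ≠ 0)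
    (hq : point r θ = Complex.I * q) {S K : ℂ}
    (hS : ∀ (l : Filter ℝ) (σ : ℝ), l ≤ 𝓝 θ → (σ = 1 ∨ σ = -1) →
      (∀ᶠ φ in l, 0 < σ * (point r φ).re) →
      Tendsto (fun φ => sMB ε M (point r φ)) l (𝓝 (S + σ * K))) :
    IsMidpointLnGamma (fun φ : ℝ => mbFormula N ε M c r φ (sMB ε M (point r φ))) r θ
      (mbFormula N ε M c r θ S) := by
  have him : (point r θ).im ≠ 0 := by rw [hq]; simpa using hq0
  have hcosθ : Real.cos θ = 0 := by
    have := point_re r θ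
    rw [hq] at this
    simpa [hr.ne'] using this.symm
  obtain ⟨σ, hσ, hgt, hlt⟩ := exists_sign_point_re hr hcosθ
  -- Re z has opposite signs on the two sides, so the limits are S - σK and S + σK.
  have hA := hS (𝓝[<] θ) (-σ) nhdsWithin_le_nhds
    (by rcases hσ with rfl | rfl <;> norm_num) hlt
  have hB := hS (𝓝[>] θ) σ nhdsWithin_le_nhds hσ hgt
  have hlim : ∀ (l : Filter ℝ) (A : ℂ), l ≤ 𝓝 θ →
      Tendsto (fun φ => sMB ε M (point r φ)) l (𝓝 A) →
      Tendsto (fun φ : ℝ => mbFormula N ε M c r φ (sMB ε M (point r φ))) l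
        (𝓝 (mbCore ε M r θ + A)) := by
    intro l A hl hA
    refine (((continuousAt_mbCore ε M hr hθ).tendsto.mono_left hl).add hA).congr' ?_
    have hev : ∀ᶠ φ in l, |φ - ε * M * Real.pi| < Real.pi :=
      hl (ContinuousAt.eventually_lt (by fun_prop) continuousAt_const hθ)
    filter_upwards [hev] with φ hφ
    exact (mbFormula_eq hN hc h0 h1 hε M hr hφ _).symm
  refine ⟨mbCore ε M r θ + (S + ((-σ : ℝ) : ℂ) * K), mbCore ε M r θ + (S + σ * K),
    hlim _ _ nhdsWithin_le_nhds hA, hlim _ _ nhdsWithin_le_nhds hB,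
    isLnGamma_of_tendsto_sMB hε M hr hθ him nhdsWithin_le_nhds hA,
    isLnGamma_of_tendsto_sMB hε M hr hθ him nhdsWithin_le_nhds hB, ?_⟩
  rw [mbFormula_eq hN hc h0 h1 hε M hr hθ]
  push_cast
  ring

/-! ### The mid-point values on the rays (M ∓ 1/2)π. -/

lemma point_inner {ε : ℝ} (hε : ε = 1 ∨ ε = -1) (M : ℕ) (r : ℝ) :
    point r (ε * ((M : ℝ) - 1 / 2) * Real.pi) = Complex.I * ((-(-1) ^ M * ε * r : ℝ) : ℂ) := by
  have hne : (ε : ℂ) * Complex.I ≠ 0 :=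
    mul_ne_zero (by rcases hε with rfl | rfl <;> norm_num) Complex.I_ne_zero
  rw [point, show ((ε * ((M : ℝ) - 1 / 2) * Real.pi : ℝ) : ℂ) * Complex.I =
    Complex.I * ε * Real.pi * M - Complex.I * ε * (Real.pi / 2) by push_cast; ring,
    Complex.exp_sub, exp_sign_mul_pi hε, exp_sign_mul_pi_div_two hε, mul_div_assoc',
    div_eq_iff hne]
  push_cast
  linear_combination (r * (-1) ^ M * Complex.I ^ 2) * sign_sq hε + r * (-1) ^ M * Complex.I_sq

lemma point_outer {ε : ℝ} (hε : ε = 1 ∨ ε = -1) (M : ℕ) (r : ℝ) :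
    point r (ε * ((M : ℝ) + 1 / 2) * Real.pi) = Complex.I * (((-1) ^ M * ε * r : ℝ) : ℂ) := by
  rw [point, show ((ε * ((M : ℝ) + 1 / 2) * Real.pi : ℝ) : ℂ) * Complex.I =
    Complex.I * ε * Real.pi * M + Complex.I * ε * (Real.pi / 2) by push_cast; ring,
    Complex.exp_add, exp_sign_mul_pi hε, exp_sign_mul_pi_div_two hε]
  push_cast
  ring

lemma sign_ne_zero {ε : ℝ} (hε : ε = 1 ∨ ε = -1) : ε ≠ 0 := by
  rcases hε with rfl | rfl <;> norm_num

lemma sMBInner_even (k : ℕ) (r : ℝ) : sMBInner (2 * k) r = -(2 * k * Real.pi * r) := by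
  simp [sMBInner, pow_succ, pow_mul]

lemma sMBInner_odd (k : ℕ) (r : ℝ) :
    sMBInner (2 * k + 1) r = 2 * k * Real.pi * r - Real.log (1 - Real.exp (-(2 * Real.pi * r))) := by
  have : (2 * k + 1) / 2 = k := by omega
  rw [sMBInner, this, show (-1 : ℝ) ^ (2 * k + 1) = -1 from Odd.neg_one_pow ⟨k, rfl⟩,
    show (-1 : ℝ) ^ (2 * k + 1 + 1) = 1 from Even.neg_one_pow ⟨k + 1, by ring⟩,
    show -2 * Real.pi * r = -(2 * Real.pi * r) by ring]
  ring

lemma sMBOuter_even (k : ℕ) (r : ℝ) : sMBOuter (2 * k) r = 2 * k * Real.pi * r := by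
  simp [sMBOuter, pow_mul]
  ring

lemma sMBOuter_odd (k : ℕ) (r : ℝ) :
    sMBOuter (2 * k + 1) r = -Real.log (1 - Real.exp (-(2 * Real.pi * r))) -
      2 * Real.pi * r * (k + 1) := by
  have : (2 * k + 1) / 2 = k := by omega
  rw [sMBOuter, this, show (-1 : ℝ) ^ (2 * k + 1) = -1 from Odd.neg_one_pow ⟨k, rfl⟩,
    show -2 * Real.pi * r = -(2 * Real.pi * r) by ring]
  ring

/-- Source of the extra -2πr in `sMBOuter` for odd M. -/
lemma log_exp_sub_one {y : ℝ} (hy : 0 < y) :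
    Real.log (Real.exp y - 1) = y + Real.log (1 - Real.exp (-y)) := by
  have h : Real.exp y - 1 = Real.exp y * (1 - Real.exp (-y)) := by
    rw [mul_sub, ← Real.exp_add, add_neg_cancel, Real.exp_zero, mul_one]
  have hlt : Real.exp (-y) < 1 := Real.exp_lt_one_iff.mpr (by linarith)
  rw [h, Real.log_mul (Real.exp_pos y).ne' (by linarith), Real.log_exp]

/-- The one-sided limits of `S_MB` on the ray `arg z = ±(M - 1/2)π`. -/
lemma exists_tendsto_sMB_inner {ε : ℝ} (hε : ε = 1 ∨ ε = -1) (M : ℕ) {r : ℝ} (hr : 0 < r) :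
    ∃ K : ℂ, ∀ (l : Filter ℝ) (σ : ℝ), l ≤ 𝓝 (ε * ((M : ℝ) - 1 / 2) * Real.pi) →
      (σ = 1 ∨ σ = -1) → (∀ᶠ φ in l, 0 < σ * (point r φ).re) →
      Tendsto (fun φ => sMB ε M (point r φ)) l (𝓝 ((sMBInner M r : ℂ) + σ * K)) := by
  have hq := point_inner hε M r
  rcases Nat.even_or_odd' M with ⟨k, rfl | rfl⟩
  · refine ⟨ε * k * Real.pi * Complex.I, fun l σ hl hσ hre => ?_⟩
    have h := (tendsto_log_neg_exp hl hq hσ hre).const_mul ((ε : ℂ) * k)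
    simp_rw [sMB_even]
    convert h using 2
    rw [sMBInner_even, pow_mul, neg_one_sq, one_pow]
    push_cast
    linear_combination (-(2 * k * Real.pi * r) : ℂ) * (-sign_sq hε)
  -- On the inner ray with M odd, εq = r > 0, so only the first logarithm jumps.
  · refine ⟨ε * k * Real.pi * Complex.I, fun l σ hl hσ hre => ?_⟩
    have hodd : (-1 : ℝ) ^ (2 * k + 1) = -1 := Odd.neg_one_pow ⟨k, rfl⟩
    have hεq : ε * (-(-1) ^ (2 * k + 1) * ε * r) = r := by
      rw [hodd]
      linear_combination r * sign_mul_self hε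
    have h := ((tendsto_log_neg_exp hl hq hσ hre).const_mul ((ε : ℂ) * k)).sub
      (tendsto_log_one_sub_exp_of_pos hl hq (by rw [hεq]; exact hr))
    simp_rw [sMB_odd]
    convert h using 2
    rw [sMBInner_odd, hεq, hodd]
    push_cast
    linear_combination (2 * k * Real.pi * r : ℂ) * (-sign_sq hε)

/-- The one-sided limits of `S_MB` on the ray `arg z = ±(M + 1/2)π`. -/
lemma exists_tendsto_sMB_outer {ε : ℝ} (hε : ε = 1 ∨ ε = -1) (M : ℕ) {r : ℝ} (hr : 0 < r) :
    ∃ K : ℂ, ∀ (l : Filter ℝ) (σ : ℝ), l ≤ 𝓝 (ε * ((M : ℝ) + 1 / 2) * Real.pi) →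
      (σ = 1 ∨ σ = -1) → (∀ᶠ φ in l, 0 < σ * (point r φ).re) →
      Tendsto (fun φ => sMB ε M (point r φ)) l (𝓝 ((sMBOuter M r : ℂ) + σ * K)) := by
  have hq := point_outer hε M r
  rcases Nat.even_or_odd' M with ⟨k, rfl | rfl⟩
  · refine ⟨ε * k * Real.pi * Complex.I, fun l σ hl hσ hre => ?_⟩
    have h := (tendsto_log_neg_exp hl hq hσ hre).const_mul ((ε : ℂ) * k)
    simp_rw [sMB_even]
    convert h using 2
    rw [sMBOuter_even, pow_mul, neg_one_sq, one_pow]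
    push_cast
    linear_combination (2 * k * Real.pi * r : ℂ) * (-sign_sq hε)
  -- On the outer ray with M odd, εq = -r < 0, so both logarithms jump and their jumps add.
  · refine ⟨ε * k * Real.pi * Complex.I + ε * Real.pi * Complex.I, fun l σ hl hσ hre => ?_⟩
    have hodd : (-1 : ℝ) ^ (2 * k + 1) = -1 := Odd.neg_one_pow ⟨k, rfl⟩
    have hεq : ε * ((-1) ^ (2 * k + 1) * ε * r) = -r := by
      rw [hodd]
      linear_combination -r * sign_mul_self hε
    have h := ((tendsto_log_neg_exp hl hq hσ hre).const_mul ((ε : ℂ) * k)).sub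
      (tendsto_log_one_sub_exp_of_neg hε hl hq (by rw [hεq]; linarith) hσ hre)
    simp_rw [sMB_odd]
    convert h using 2
    rw [sMBOuter_odd, hεq, hodd, mul_neg, neg_neg,
      log_exp_sub_one (by have := Real.pi_pos; positivity)]
    push_cast
    linear_combination (-(2 * k * Real.pi * r) : ℂ) * (-sign_sq hε)

end Stirling
end

theorem theorem4p1 (N M : ℕ) (hN : 1 ≤ N) (ε : ℝ) (hε : ε = 1 ∨ ε = -1)
    (c : ℝ) (hc₁ : max ((N : ℝ) - 1) (1 / 2) < c) (hc₂ : c < (N : ℝ))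
    (r θ : ℝ) (hr : 0 < r)
    (hθ₁ : (ε * (M : ℝ) - 1) * Real.pi < θ) (hθ₂ : θ < (ε * (M : ℝ) + 1) * Real.pi) :
    MeasureTheory.Integrable
        (fun t : ℝ => Stirling.mbIntegrand ε M r θ ((c : ℂ) + (t : ℂ) * Complex.I)) ∧
      ((∀ k : ℤ, θ ≠ ((k : ℝ) + 1 / 2) * Real.pi) →
        (∀ n : ℕ, Stirling.point r θ ≠ -(n : ℂ)) →
        Stirling.IsLnGamma r θ
          (Stirling.mbFormula N ε M c r θ (Stirling.sMB ε M (Stirling.point r θ)))) ∧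
      (θ = ε * ((M : ℝ) - 1 / 2) * Real.pi →
        Stirling.IsMidpointLnGamma
          (fun φ : ℝ => Stirling.mbFormula N ε M c r φ (Stirling.sMB ε M (Stirling.point r φ)))
          r θ (Stirling.mbFormula N ε M c r θ (Stirling.sMBInner M r : ℂ))) ∧
      (θ = ε * ((M : ℝ) + 1 / 2) * Real.pi →
        Stirling.IsMidpointLnGamma
          (fun φ : ℝ => Stirling.mbFormula N ε M c r φ (Stirling.sMB ε M (Stirling.point r φ)))
          r θ (Stirling.mbFormula N ε M c r θ (Stirling.sMBOuter M r : ℂ))) := by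
  have hcN : (N : ℝ) - 1 < c := (le_max_left _ _).trans_lt hc₁
  have hc : 1 / 2 < c := (le_max_right _ _).trans_lt hc₁
  have hθ : |θ - ε * M * Real.pi| < Real.pi := by
    rw [abs_lt]; constructor <;> linarith
  have hε0 := Stirling.sign_ne_zero hε
  have hpow : (-1 : ℝ) ^ M ≠ 0 := pow_ne_zero _ (by norm_num)
  refine ⟨Stirling.integrable_mbIntegrand hc
    (Stirling.sin_pi_mul_ne_zero_of_mem_Ioo hcN hc₂) ε M r θ hθ, fun _ hpole => ?_, ?_, ?_⟩
  · rw [Stirling.mbFormula_eq hN hc hcN hc₂ hε M hr hθ]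
    exact Stirling.isLnGamma_mbCore_add_sMB hε M hr hθ hpole
  · rintro rfl
    obtain ⟨K, hK⟩ := Stirling.exists_tendsto_sMB_inner hε M hr
    exact Stirling.isMidpointLnGamma_of_sMB hN hc hcN hc₂ hε M hr hθ
      (mul_ne_zero (mul_ne_zero (neg_ne_zero.mpr hpow) hε0) hr.ne')
      (Stirling.point_inner hε M r) hK
  · rintro rfl
    obtain ⟨K, hK⟩ := Stirling.exists_tendsto_sMB_outer hε M hr
    exact Stirling.isMidpointLnGamma_of_sMB hN hc hcN hc₂ hε M hr hθ
      (mul_ne_zero (mul_ne_zero hpow hε0) hr.ne') (Stirling.point_outer hε M r) hK
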